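/- All graphs are finite, undirected and simple. A graph is $H$-free if it has no induced subgraph isomorphic to $H$. $P_4$ is the path on four vertices, and $H+P_4$ is the disjoint union of $H$ and $P_4$. A perfect matching cut of a graph $G=(V,E)$ is a perfect matching $M\subseteq E$ of $G$ for which $V$ can be partitioned into two non-empty sets $B$ and $R$ such that $M$ is exactly the set of edges of $G$ with one end-vertex in $B$ and the other in $R$. The problem Perfect Matching Cut asks whether a given connected graph has a perfect matching cut. For a graph $H$, the problem is polynomial-time solvable for $H$-free graphs if some algorithm decides it correctly for every connected $H$-free input graph $G$, in a number of steps that is at most polynomial in $|V(G)|$ on every such input. (Steps are those of a unit-cost random access machine with addition and truncated subtraction, with $G$ given by its adjacency matrix.) Theorem. Let $H$ be a graph. If Perfect Matching Cut is polynomial-time solvable for $H$-free graphs, then Perfect Matching Cut is polynomial-time solvable for $(H+P_4)$-free graphs. -/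

import Mathlib

/-! ### Perfect matching cuts -/

namespace PMC

/-- `G` has a perfect matching cut: a perfect matching `M` of `G` that is also an edge cut, that is,
the vertex set is partitioned into two non-empty parts `B` and `Bᶜ` such that the edges of `M` are
exactly the edges of `G` with one end in `B` and the other end in `Bᶜ`. -/
def HasPerfectMatchingCut {V : Type*} (G : SimpleGraph V) : Prop :=
  ∃ M : G.Subgraph, M.IsPerfectMatching ∧
    ∃ B : Set V, B.Nonempty ∧ Bᶜ.Nonempty ∧
      ∀ u v : V, M.Adj u v ↔ G.Adj u v ∧ ((u ∈ B ∧ v ∈ Bᶜ) ∨ (u ∈ Bᶜ ∧ v ∈ B))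

/-- `G` is `H`-free: it has no induced subgraph isomorphic to `H`. -/
def IsFree {W V : Type*} (H : SimpleGraph W) (G : SimpleGraph V) : Prop :=
  ¬ H.IsIndContained G

/-! ### Random access machines

Structured programs for a random access machine over the natural numbers, with registers
`0, 1, 2, …` and memory banks `0, 1, 2, …`, each bank being a sequence of cells (a fixed program
mentions only finitely many registers and banks). The arithmetic operations are addition and
truncated subtraction. There is no multiplication, so in `t` steps the bit length of the numbers
grows by at most `O(t)`, and running times under the unit-cost measure used here are polynomially
related to those of Turing machines. -/

/-- Contents of the registers and of the memory banks. -/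
structure RamState where
  /-- contents of the registers -/
  reg : ℕ → ℕ
  /-- `bank a i` is the content of cell `i` of bank `a` -/
  bank : ℕ → ℕ → ℕ

/-- Write the value `v` to register `x`. -/
def RamState.setReg (s : RamState) (x v : ℕ) : RamState :=
  { s with reg := Function.update s.reg x v }

/-- Write the value `v` to cell `i` of bank `a`. -/
def RamState.setCell (s : RamState) (a i v : ℕ) : RamState :=
  { s with bank := Function.update s.bank a (Function.update (s.bank a) i v) }

/-- Arithmetic expressions. -/
inductive RamExpr : Type
  /-- a numeral -/
  | const (c : ℕ)
  /-- the content of register `x` -/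
  | var (x : ℕ)
  /-- the content of the cell of bank `a` whose address is the value of `i` -/
  | get (a : ℕ) (i : RamExpr)
  /-- sum -/
  | add (e f : RamExpr)
  /-- truncated difference -/
  | sub (e f : RamExpr)

/-- Value of an expression. -/
def RamExpr.eval (s : RamState) : RamExpr → ℕ
  | .const c => c
  | .var x => s.reg x
  | .get a i => s.bank a (i.eval s)
  | .add e f => e.eval s + f.eval s
  | .sub e f => e.eval s - f.eval s

/-- Number of elementary operations performed when an expression is evaluated. -/
def RamExpr.cost : RamExpr → ℕ
  | .const _ => 1
  | .var _ => 1
  | .get _ i => i.cost + 1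
  | .add e f => e.cost + f.cost + 1
  | .sub e f => e.cost + f.cost + 1

/-- Programs. A test succeeds if the value of the tested expression is not zero. -/
inductive RamProg : Type
  /-- do nothing -/
  | skip
  /-- write the value of `e` to register `x` -/
  | assign (x : ℕ) (e : RamExpr)
  /-- write the value of `e` to the cell of bank `a` whose address is the value of `i` -/
  | put (a : ℕ) (i e : RamExpr)
  /-- first `P`, then `Q` -/
  | seq (P Q : RamProg)
  /-- if `e ≠ 0` then `P`, else `Q` -/
  | ite (e : RamExpr) (P Q : RamProg)
  /-- while `e ≠ 0` do `P` -/
  | loop (e : RamExpr) (P : RamProg)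

/-- `Exec P s s' t`: the program `P`, started in the state `s`, halts in the state `s'` after
exactly `t` steps. -/
inductive Exec : RamProg → RamState → RamState → ℕ → Prop
  | skip (s : RamState) : Exec .skip s s 1
  | assign (s : RamState) (x : ℕ) (e : RamExpr) :
      Exec (.assign x e) s (s.setReg x (e.eval s)) (e.cost + 1)
  | put (s : RamState) (a : ℕ) (i e : RamExpr) :
      Exec (.put a i e) s (s.setCell a (i.eval s) (e.eval s)) (i.cost + e.cost + 1)
  | seq {P Q : RamProg} {s s₁ s₂ : RamState} {t₁ t₂ : ℕ} :
      Exec P s s₁ t₁ → Exec Q s₁ s₂ t₂ → Exec (.seq P Q) s s₂ (t₁ + t₂)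
  | ite_true {e : RamExpr} {P Q : RamProg} {s s' : RamState} {t : ℕ} :
      e.eval s ≠ 0 → Exec P s s' t → Exec (.ite e P Q) s s' (e.cost + 1 + t)
  | ite_false {e : RamExpr} {P Q : RamProg} {s s' : RamState} {t : ℕ} :
      e.eval s = 0 → Exec Q s s' t → Exec (.ite e P Q) s s' (e.cost + 1 + t)
  | loop_true {e : RamExpr} {P : RamProg} {s s₁ s₂ : RamState} {t₁ t₂ : ℕ} :
      e.eval s ≠ 0 → Exec P s s₁ t₁ → Exec (.loop e P) s₁ s₂ t₂ →
        Exec (.loop e P) s s₂ (e.cost + 1 + t₁ + t₂)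
  | loop_false {e : RamExpr} {P : RamProg} {s : RamState} :
      e.eval s = 0 → Exec (.loop e P) s s (e.cost + 1)

/-! ### Decision problems on graphs and polynomial time -/

open Classical in
/-- Initial state on input `G`: register `0` holds the number `n` of vertices, bank `0` holds the
adjacency matrix of `G` row by row (entry `(i, j)` in cell `i * n + j`), everything else is `0`. -/
noncomputable def inputState {n : ℕ} (G : SimpleGraph (Fin n)) : RamState where
  reg x := if x = 0 then n else 0
  bank a k := if a = 0 ∧ ∃ i j : Fin n, k = (i : ℕ) * n + (j : ℕ) ∧ G.Adj i j then 1 else 0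

/-- The decision problem with set `Q` of yes-instances, restricted to the graphs of the class `C`,
is polynomial-time solvable: there are one program and one polynomial `p` such that on every
`n`-vertex graph of the class, the program halts within `p n` steps, with output (the final content
of register `0`) equal to `1` on yes-instances and to `0` on no-instances. Nothing is required on
inputs outside the class. -/
def PolyTimeSolvableOn (C Q : ∀ {n : ℕ}, SimpleGraph (Fin n) → Prop) : Prop :=
  ∃ (P : RamProg) (p : Polynomial ℕ), ∀ (n : ℕ) (G : SimpleGraph (Fin n)), C G →
    ∃ (s : RamState) (t : ℕ), Exec P (inputState G) s t ∧ t ≤ p.eval n ∧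
      (Q G → s.reg 0 = 1) ∧ (¬ Q G → s.reg 0 = 0)

/-- Perfect Matching Cut, whose instances are connected graphs, is polynomial-time solvable for
`H`-free graphs. -/
def PerfectMatchingCutPolyOnFree {W : Type*} (H : SimpleGraph W) : Prop :=
  PolyTimeSolvableOn (fun G => G.Connected ∧ IsFree H G) (fun G => HasPerfectMatchingCut G)

end PMC

/-! Search for an induced copy of `H`. If there is none, the given algorithm applies. Otherwise a
perfect matching cut is treated as a 2-coloring in which every vertex has exactly one neighbor of
the other color, its partner. Some tuple of vertices lists a copy of `H`, the partners of its
vertices, and one further pair, split by color; there are polynomially many tuples, and each serves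
as a seed that is completed greedily.

Partial colorings are closed under two rounds of lookahead: a color that fails in a trial is
excluded. In a closed extension of a good seed each vertex of the copy sees its partner, so it
passes its color to all its other neighbors. Hence the uncolored vertices lie outside the copy and
have no neighbors in it, and in an `H + P₄`-free graph they induce no `P₄`.

Let `Q` be such a closed coloring below a perfect coloring `σ`. An uncolored component containing an
edge that is bichromatic under `σ` is either a four-cycle, excluded by trials and connectedness, or
is dominated by one end of that edge while the other end is pendant (`structure_of_bichromatic`,
`not_isFourCycle`). Trials then show that an uncolored vertex with a colored neighbor has colored
neighbors of both colors (`exists_colored_nbr`), and exactly one of each, since two neighbors of one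
color would force its color. Double counting yields that a colored vertex has at most two uncolored
neighbors (`eq_or_eq_of_uncolored`).

Consequently a closed extension `R` of `Q` spreads along every edge and through every colored vertex
at which it colors something: each closed neighborhood is colored completely by `R`, or `R` adds
nothing to it. Taking `R` where it is defined and `σ` elsewhere gives a perfect coloring
(`exists_perfect`). So a consistent trial never destroys solvability, and the greedy completion
succeeds without backtracking. A final check makes wrong seeds harmless. -/

namespace PMC

/-! ### Programs with bounded loops -/

/-- Programs whose only loops are `each x P`: run `P` for all values `0, …, n - 1` of register `x`,
where `n` is the content of register `0`, while register `x + 1` holds the product of `x` and `n`. -/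
inductive ForProg : Type
  | skip
  | assign (x : ℕ) (e : RamExpr)
  | put (a : ℕ) (i e : RamExpr)
  | seq (P Q : ForProg)
  | ite (e : RamExpr) (P Q : ForProg)
  | each (x : ℕ) (P : ForProg)

/-- Advance the loop register `x` and its multiple in register `x + 1`. -/
def RamState.bump (s : RamState) (x : ℕ) : RamState :=
  (s.setReg x (s.reg x + 1)).setReg (x + 1)
    ((s.setReg x (s.reg x + 1)).reg (x + 1) + (s.setReg x (s.reg x + 1)).reg 0)

namespace ForProg

/-- Final state of a program. -/
def run : ForProg → RamState → RamState
  | skip, s => s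
  | assign x e, s => s.setReg x (e.eval s)
  | put a i e, s => s.setCell a (i.eval s) (e.eval s)
  | seq P Q, s => Q.run (P.run s)
  | ite e P Q, s => if e.eval s ≠ 0 then P.run s else Q.run s
  | each x P, s => (fun s => (P.run s).bump x)^[s.reg 0] ((s.setReg x 0).setReg (x + 1) 0)

/-- Registers a program may write to. -/
def WritesReg : ForProg → ℕ → Prop
  | skip, _ => False
  | assign x _, y => y = x
  | put _ _ _, _ => False
  | seq P Q, y => P.WritesReg y ∨ Q.WritesReg y
  | ite _ P Q, y => P.WritesReg y ∨ Q.WritesReg y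
  | each x P, y => y = x ∨ y = x + 1 ∨ P.WritesReg y

/-- Banks a program may write to. -/
def WritesBank : ForProg → ℕ → Prop
  | skip, _ => False
  | assign _ _, _ => False
  | put a _ _, b => b = a
  | seq P Q, b => P.WritesBank b ∨ Q.WritesBank b
  | ite _ P Q, b => P.WritesBank b ∨ Q.WritesBank b
  | each _ P, b => P.WritesBank b

/-- No program part writes to register `0`, and loop bodies do not write to their loop registers. -/
def WellFormed : ForProg → Prop
  | skip => True
  | assign x _ => x ≠ 0
  | put _ _ _ => True
  | seq P Q => P.WellFormed ∧ Q.WellFormed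
  | ite _ P Q => P.WellFormed ∧ Q.WellFormed
  | each x P => x ≠ 0 ∧ ¬ P.WritesReg x ∧ ¬ P.WritesReg (x + 1) ∧ P.WellFormed

/-- Translation into programs of the random access machine. -/
def compile : ForProg → RamProg
  | skip => .skip
  | assign x e => .assign x e
  | put a i e => .put a i e
  | seq P Q => .seq P.compile Q.compile
  | ite e P Q => .ite e P.compile Q.compile
  | each x P => .seq (.assign x (.const 0)) (.seq (.assign (x + 1) (.const 0))
      (.loop (.sub (.var 0) (.var x)) (.seq P.compile
        (.seq (.assign x (.add (.var x) (.const 1)))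
          (.assign (x + 1) (.add (.var (x + 1)) (.var 0)))))))

open Polynomial in
/-- A polynomial that bounds the running time. -/
noncomputable def cost : ForProg → Polynomial ℕ
  | skip => 1
  | assign _ e => C (e.cost + 1)
  | put _ i e => C (i.cost + e.cost + 1)
  | seq P Q => P.cost + Q.cost
  | ite e P Q => C (e.cost + 1) + (P.cost + Q.cost)
  -- Initializing the loop registers costs 4 and the last, failing test costs 4; each round pays 4
  -- for its test and 4 for each of the two increments.
  | each _ P => 8 + X * (P.cost + 12)

end ForProg

/-! ### Registers and cells after elementary writes. -/

@[simp] theorem RamState.setReg_reg (s : RamState) (x v y : ℕ) :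
    (s.setReg x v).reg y = if y = x then v else s.reg y := by
  simp [RamState.setReg, Function.update_apply]

@[simp] theorem RamState.setReg_bank (s : RamState) (x v : ℕ) :
    (s.setReg x v).bank = s.bank := rfl

@[simp] theorem RamState.setCell_reg (s : RamState) (a i v : ℕ) :
    (s.setCell a i v).reg = s.reg := rfl

theorem RamState.setCell_bank (s : RamState) (a i v b j : ℕ) :
    (s.setCell a i v).bank b j = if b = a ∧ j = i then v else s.bank b j := by
  by_cases hb : b = a
  · subst hb; simp [RamState.setCell, Function.update_apply]
  · simp [RamState.setCell, hb]

theorem RamState.setCell_bank_of_ne (s : RamState) {a b : ℕ} (i v : ℕ) (h : b ≠ a) :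
    (s.setCell a i v).bank b = s.bank b := by
  simp [RamState.setCell, h]

theorem RamState.bump_reg_of_ne (s : RamState) {x y : ℕ} (h : y ≠ x) (h' : y ≠ x + 1) :
    (s.bump x).reg y = s.reg y := by
  simp [RamState.bump, h, h']

@[simp] theorem RamState.bump_bank (s : RamState) (x : ℕ) : (s.bump x).bank = s.bank := rfl

theorem RamState.bump_reg_self (s : RamState) (x : ℕ) : (s.bump x).reg x = s.reg x + 1 := by
  simp [RamState.bump]

theorem RamState.bump_reg_succ (s : RamState) {x : ℕ} (hx : x ≠ 0) :
    (s.bump x).reg (x + 1) = s.reg (x + 1) + s.reg 0 := by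
  simp [RamState.bump, hx.symm]

/-! ### Frame rules, loop induction and running time. -/

namespace ForProg

theorem run_reg_of_not_writes {P : ForProg} {y : ℕ} (h : ¬ P.WritesReg y) (s : RamState) :
    (P.run s).reg y = s.reg y := by
  induction P generalizing s with
  | skip => rfl
  | assign x e => simp only [WritesReg] at h; simp [run, h]
  | put a i e => rfl
  | seq P Q ihP ihQ =>
    simp only [WritesReg, not_or] at h
    simp only [run]
    rw [ihQ h.2, ihP h.1]
  | ite e P Q ihP ihQ =>
    simp only [WritesReg, not_or] at h
    simp only [run]
    split_ifs
    · exact ihP h.1 s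
    · exact ihQ h.2 s
  | each x P ih =>
    simp only [WritesReg, not_or] at h
    simp only [run]
    have key : ∀ (k : ℕ) (s : RamState),
        ((fun s => (P.run s).bump x)^[k] s).reg y = s.reg y := by
      intro k
      induction k with
      | zero => intro s; rfl
      | succ k ihk =>
        intro s
        rw [Function.iterate_succ_apply, ihk, RamState.bump_reg_of_ne _ h.1 h.2.1, ih h.2.2]
    rw [key]
    simp [h.1, h.2.1]

theorem run_bank_of_not_writes {P : ForProg} {a : ℕ} (h : ¬ P.WritesBank a) (s : RamState) :
    (P.run s).bank a = s.bank a := by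
  induction P generalizing s with
  | skip => rfl
  | assign x e => rfl
  | put b i e =>
    simp only [WritesBank] at h
    exact RamState.setCell_bank_of_ne _ _ _ h
  | seq P Q ihP ihQ =>
    simp only [WritesBank, not_or] at h
    simp only [run]
    rw [ihQ h.2, ihP h.1]
  | ite e P Q ihP ihQ =>
    simp only [WritesBank, not_or] at h
    simp only [run]
    split_ifs
    · exact ihP h.1 s
    · exact ihQ h.2 s
  | each x P ih =>
    simp only [WritesBank] at h
    simp only [run]
    have key : ∀ (k : ℕ) (s : RamState),
        ((fun s => (P.run s).bump x)^[k] s).bank a = s.bank a := by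
      intro k
      induction k with
      | zero => intro s; rfl
      | succ k ihk =>
        intro s
        rw [Function.iterate_succ_apply, ihk, RamState.bump_bank, ih h]
    rw [key]
    simp

theorem WellFormed.not_writesReg_zero {P : ForProg} (h : P.WellFormed) : ¬ P.WritesReg 0 := by
  induction P with
  | skip => exact id
  | assign x e => exact fun h' => h h'.symm
  | put a i e => exact id
  | seq P Q ihP ihQ => exact not_or.2 ⟨ihP h.1, ihQ h.2⟩
  | ite e P Q ihP ihQ => exact not_or.2 ⟨ihP h.1, ihQ h.2⟩
  | each x P ih =>
    simp only [WritesReg, not_or]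
    exact ⟨h.1.symm, by omega, ih h.2.2.2⟩

/-- Induction principle for loops. -/
theorem run_each_induct {P : ForProg} {x : ℕ} (hw : (each x P).WellFormed) {s₀ : RamState}
    {n : ℕ} (hn : s₀.reg 0 = n) (Inv : ℕ → RamState → Prop)
    -- The loop registers are written outside `P`, by the initialization and by `bump`, so the
    -- invariant has to survive such writes.
    (stable : ∀ k s v w, Inv k s → Inv k ((s.setReg x v).setReg (x + 1) w))
    (zero : Inv 0 s₀)
    (step : ∀ k s, k < n →
      (∀ y, y ≠ x → y ≠ x + 1 → ¬ P.WritesReg y → s.reg y = s₀.reg y) →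
      (∀ a, ¬ P.WritesBank a → s.bank a = s₀.bank a) →
      s.reg x = k → s.reg (x + 1) = k * n → Inv k s → Inv (k + 1) (P.run s)) :
    Inv (n) ((each x P).run s₀) := by
  subst hn
  obtain ⟨hx, hPx, hPx1, hP⟩ := hw
  have hP0 := hP.not_writesReg_zero
  have key : ∀ k, k ≤ s₀.reg 0 → ∀ s,
      s = (fun s => (P.run s).bump x)^[k] ((s₀.setReg x 0).setReg (x + 1) 0) →
      (∀ y, y ≠ x → y ≠ x + 1 → ¬ P.WritesReg y → s.reg y = s₀.reg y) ∧
      (∀ a, ¬ P.WritesBank a → s.bank a = s₀.bank a) ∧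
      s.reg x = k ∧ s.reg (x + 1) = k * s₀.reg 0 ∧ Inv k s := by
    intro k
    induction k with
    | zero =>
      rintro - s rfl
      refine ⟨fun y h1 h2 _ => by simp [h1, h2], fun a _ => rfl, by simp, by simp, ?_⟩
      exact stable _ _ _ _ zero
    | succ k ih =>
      rintro hk s rfl
      rw [Function.iterate_succ_apply']
      obtain ⟨h1, h2, h3, h4, h5⟩ := ih (by omega) _ rfl
      set s := (fun s => (P.run s).bump x)^[k] ((s₀.setReg x 0).setReg (x + 1) 0)
      refine ⟨fun y hy hy' hyP => ?_, fun a ha => ?_, ?_, ?_, ?_⟩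
      · rw [RamState.bump_reg_of_ne _ hy hy', run_reg_of_not_writes hyP, h1 y hy hy' hyP]
      · rw [RamState.bump_bank, run_bank_of_not_writes ha, h2 a ha]
      · rw [RamState.bump_reg_self, run_reg_of_not_writes hPx, h3]
      · rw [RamState.bump_reg_succ _ hx, run_reg_of_not_writes hPx1, run_reg_of_not_writes hP0, h4,
          h1 0 hx.symm (by omega) hP0]
        ring
      · exact stable _ _ _ _ (step k s (by omega) h1 h2 h3 h4 h5)
  exact (key _ le_rfl _ rfl).2.2.2.2

/-- Induction on the distance `k` of the loop register from its bound: the body changes neither of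
them, so each round lowers the distance by one and the cost bound of the body stays the same. -/
theorem exec_loop {P : ForProg} {x : ℕ} (hx : x ≠ 0) (hPx : ¬ P.WritesReg x)
    (hP0 : ¬ P.WritesReg 0)
    (ih : ∀ s, ∃ t, Exec P.compile s (P.run s) t ∧ t ≤ P.cost.eval (s.reg 0)) (k : ℕ) :
    ∀ s : RamState, s.reg 0 - s.reg x = k →
      ∃ t, Exec (.loop (.sub (.var 0) (.var x)) (.seq P.compile
        (.seq (.assign x (.add (.var x) (.const 1)))
          (.assign (x + 1) (.add (.var (x + 1)) (.var 0))))))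
        s ((fun s => (P.run s).bump x)^[k] s) t ∧ t ≤ 4 + k * (P.cost.eval (s.reg 0) + 12) := by
  induction k with
  | zero =>
    intro s hs
    exact ⟨_, Exec.loop_false (by simpa [RamExpr.eval] using hs), by simp [RamExpr.cost]⟩
  | succ k ihk =>
    intro s hs
    obtain ⟨t, ht, htle⟩ := ih s
    have h0 : ((P.run s).bump x).reg 0 = s.reg 0 := by
      rw [RamState.bump_reg_of_ne _ hx.symm (by omega), run_reg_of_not_writes hP0]
    obtain ⟨t', ht', htle'⟩ := ihk ((P.run s).bump x) (by
      rw [h0, RamState.bump_reg_self, run_reg_of_not_writes hPx]; omega)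
    refine ⟨_, Exec.loop_true (by simp [RamExpr.eval, hs])
      (Exec.seq ht (Exec.seq (Exec.assign _ _ _) (Exec.assign _ _ _))) ht', ?_⟩
    rw [h0] at htle'
    simp only [RamExpr.cost]
    linarith

/-- The translation computes `run` within the time bound. -/
theorem exec_compile {P : ForProg} (h : P.WellFormed) (s : RamState) :
    ∃ t, Exec P.compile s (P.run s) t ∧ t ≤ P.cost.eval (s.reg 0) := by
  induction P generalizing s with
  | skip => exact ⟨_, Exec.skip s, by simp [cost]⟩
  | assign x e => exact ⟨_, Exec.assign s x e, by simp [cost]⟩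
  | put a i e => exact ⟨_, Exec.put s a i e, by simp [cost]⟩
  | seq P Q ihP ihQ =>
    obtain ⟨t, ht, htle⟩ := ihP h.1 s
    obtain ⟨t', ht', htle'⟩ := ihQ h.2 (P.run s)
    rw [run_reg_of_not_writes h.1.not_writesReg_zero] at htle'
    exact ⟨_, Exec.seq ht ht', by simp only [cost, Polynomial.eval_add]; omega⟩
  | ite e P Q ihP ihQ =>
    obtain ⟨t, ht, htle⟩ := ihP h.1 s
    obtain ⟨t', ht', htle'⟩ := ihQ h.2 s
    by_cases he : e.eval s = 0
    · refine ⟨_, by simpa [run, compile, he] using Exec.ite_false he ht', ?_⟩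
      simp only [cost, Polynomial.eval_add, Polynomial.eval_C]; omega
    · refine ⟨_, by simpa [run, compile, he] using Exec.ite_true he ht, ?_⟩
      simp only [cost, Polynomial.eval_add, Polynomial.eval_C]; omega
  | each x P ih =>
    obtain ⟨hx, hPx, hPx1, hP⟩ := h
    have h0 : ((s.setReg x 0).setReg (x + 1) 0).reg 0 = s.reg 0 := by simp [hx.symm]
    obtain ⟨t, ht, htle⟩ := exec_loop hx hPx hP.not_writesReg_zero (ih hP) (s.reg 0)
      ((s.setReg x 0).setReg (x + 1) 0) (by rw [h0]; simp)
    refine ⟨_, Exec.seq (Exec.assign _ _ _) (Exec.seq (Exec.assign _ _ _) ht), ?_⟩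
    rw [h0] at htle
    simp only [cost, RamExpr.cost, Polynomial.eval_add, Polynomial.eval_mul, Polynomial.eval_X,
      Polynomial.eval_ofNat]
    omega

end ForProg

/-! ### Perfect matching cuts as colorings

A partial coloring is a function with values `0` (not colored), `1` and `2`. -/

section Coloring

variable {V : Type*}

/-- All values are `0`, `1` or `2`. -/
def IsPartial (P : V → ℕ) : Prop := ∀ v, P v ≤ 2

/-- `Q` extends the partial coloring `P`. -/
def Extends (P Q : V → ℕ) : Prop := ∀ v, P v ≠ 0 → Q v = P v

/-- A coloring with colors `1` and `2` in which each vertex has exactly one neighbor of the other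
color. -/
def IsPerfect (G : SimpleGraph V) (σ : V → ℕ) : Prop :=
  (∀ v, σ v = 1 ∨ σ v = 2) ∧ ∀ v, ∃! w, G.Adj v w ∧ σ w ≠ σ v

/-- No colored vertex violates the condition of a perfect coloring for good. -/
def IsConsistent (G : SimpleGraph V) (P : V → ℕ) : Prop :=
  -- An uncolored neighbor `d` also satisfies `P d ≠ P c`: it may still become the partner of `c`.
  ∀ c, P c ≠ 0 → (∃ d, G.Adj c d ∧ P d ≠ P c) ∧
    ∀ d d', G.Adj c d → G.Adj c d' → P d ≠ 0 → P d ≠ P c → P d' ≠ 0 → P d' ≠ P c → d = d'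

/-- Consistency after `k` rounds of lookahead. -/
def IsClosed (G : SimpleGraph V) : ℕ → (V → ℕ) → Prop
  | 0, P => IsPartial P ∧ IsConsistent G P
  | k + 1, P => IsPartial P ∧ IsConsistent G P ∧ ∀ u, P u = 0 → ∀ x, x = 1 ∨ x = 2 →
      ∃ Q, Extends P Q ∧ Q u = x ∧ IsClosed G k Q

/-- The matching is the set of bichromatic edges. As soon as there is a vertex, both color classes
are non-empty, because a vertex and its partner have different colors. -/
theorem hasPerfectMatchingCut_iff [Nonempty V] (G : SimpleGraph V) :
    HasPerfectMatchingCut G ↔ ∃ σ, IsPerfect G σ := by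
  classical
  constructor
  · rintro ⟨M, hM, B, -, -, hB⟩
    refine ⟨fun v => if v ∈ B then 1 else 2, fun v => by by_cases h : v ∈ B <;> simp [h], ?_⟩
    intro v
    obtain ⟨w, hw, huniq⟩ := SimpleGraph.Subgraph.isPerfectMatching_iff.1 hM v
    have key : ∀ w, (G.Adj v w ∧ (if w ∈ B then 1 else 2) ≠ (if v ∈ B then 1 else 2)) ↔
        M.Adj v w := by
      intro w
      rw [hB]
      by_cases h1 : v ∈ B <;> by_cases h2 : w ∈ B <;> simp [h1, h2]
    exact ⟨w, (key w).2 hw, fun y hy => huniq y ((key y).1 hy)⟩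
  · rintro ⟨σ, hσ, hex⟩
    let M : G.Subgraph :=
      { verts := Set.univ
        Adj := fun u v => G.Adj u v ∧ σ v ≠ σ u
        adj_sub := fun h => h.1
        edge_vert := fun _ => Set.mem_univ _
        symm := ⟨fun u v h => ⟨h.1.symm, h.2.symm⟩⟩ }
    have hother : ∀ u v, σ v ≠ σ u ↔ (σ u = 1 ∧ σ v ≠ 1) ∨ (σ u ≠ 1 ∧ σ v = 1) := by
      intro u v
      rcases hσ u with h | h <;> rcases hσ v with h' | h' <;> simp [h, h']
    refine ⟨M, SimpleGraph.Subgraph.isPerfectMatching_iff.2 hex, {v | σ v = 1}, ?_, ?_, ?_⟩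
    · obtain ⟨v⟩ := ‹Nonempty V›
      obtain ⟨w, ⟨-, hw⟩, -⟩ := hex v
      rcases (hother v w).1 hw with h | h
      · exact ⟨v, h.1⟩
      · exact ⟨w, h.2⟩
    · obtain ⟨v⟩ := ‹Nonempty V›
      obtain ⟨w, ⟨-, hw⟩, -⟩ := hex v
      rcases (hother v w).1 hw with h | h
      · exact ⟨w, h.2⟩
      · exact ⟨v, h.1⟩
    · intro u v
      exact and_congr_right fun _ => hother u v

variable {G : SimpleGraph V} {P Q σ : V → ℕ}

theorem Extends.refl (P : V → ℕ) : Extends P P := fun _ _ => rfl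

theorem Extends.trans {R : V → ℕ} (h : Extends P Q) (h' : Extends Q R) : Extends P R :=
  fun v hv => by rw [h' v (by rw [h v hv]; exact hv), h v hv]

theorem extends_update [DecidableEq V] {u : V} (hu : P u = 0) (x : ℕ) :
    Extends P (Function.update P u x) := by
  intro v hv
  rw [Function.update_of_ne]
  rintro rfl
  exact hv hu

theorem Extends.update [DecidableEq V] {u : V} {x : ℕ} (h : Extends P Q) (hu : Q u = x) :
    Extends (Function.update P u x) Q := by
  intro v hv
  by_cases hvu : v = u
  · subst hvu; simpa using hu
  · rw [Function.update_of_ne hvu] at hv ⊢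
    exact h v hv

theorem IsPerfect.ne_zero (hσ : IsPerfect G σ) (v : V) : σ v ≠ 0 := by
  rcases hσ.1 v with h | h <;> simp [h]

theorem IsPerfect.isConsistent (hσ : IsPerfect G σ) : IsConsistent G σ := by
  intro c _
  obtain ⟨w, hw, huniq⟩ := hσ.2 c
  exact ⟨⟨w, hw⟩, fun d d' h h' _ hd _ hd' =>
    (huniq d ⟨h, hd⟩).trans (huniq d' ⟨h', hd'⟩).symm⟩

/-- Erasing colors only adds possible partners and removes conflicts. The contrapositive is what
makes a failed trial conclusive for all extensions. -/
theorem IsConsistent.of_extends (hQ : IsConsistent G Q) (h : Extends P Q) :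
    IsConsistent G P := by
  intro c hc
  have hc' := h c hc
  obtain ⟨⟨d, hd, hne⟩, huniq⟩ := hQ c (by rw [hc']; exact hc)
  refine ⟨⟨d, hd, fun h' => hne ?_⟩, fun d d' hd hd' h1 h2 h3 h4 => ?_⟩
  · rw [h d (by rw [h']; exact hc), h', hc']
  · have e1 := h d h1
    have e2 := h d' h3
    exact huniq d d' hd hd' (by rwa [e1]) (by rwa [e1, hc']) (by rwa [e2]) (by rwa [e2, hc'])

theorem IsClosed.isPartial {k : ℕ} (h : IsClosed G k P) : IsPartial P := by
  cases k with
  | zero => exact h.1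
  | succ k => exact h.1

theorem IsClosed.isConsistent {k : ℕ} (h : IsClosed G k P) : IsConsistent G P := by
  cases k with
  | zero => exact h.2
  | succ k => exact h.2.1

theorem IsClosed.of_succ {k : ℕ} (h : IsClosed G (k + 1) P) : IsClosed G k P := by
  induction k generalizing P with
  | zero => exact ⟨h.1, h.2.1⟩
  | succ k ih =>
    refine ⟨h.1, h.2.1, fun u hu x hx => ?_⟩
    obtain ⟨Q, hQ, hQu, hQ'⟩ := h.2.2 u hu x hx
    exact ⟨Q, hQ, hQu, ih hQ'⟩

theorem IsPerfect.of_isConsistent (hP : IsPartial P) (h0 : ∀ v, P v ≠ 0) (h : IsConsistent G P) :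
    IsPerfect G P := by
  refine ⟨fun v => ?_, fun v => ?_⟩
  · have := hP v
    have := h0 v
    omega
  · obtain ⟨⟨d, hd⟩, huniq⟩ := h v (h0 v)
    exact ⟨d, hd, fun y hy => huniq y d hy.1 hd.1 (h0 y) hy.2 (h0 d) hd.2⟩

/-! #### Propagation in closed partial colorings -/

/-- A vertex whose colored neighborhood contains two vertices of the same color has that color. -/
theorem IsClosed.eq_of_two (h : IsClosed G 1 P) {u c c' : V} (hc : G.Adj u c) (hc' : G.Adj u c')
    (hne : c ≠ c') (h0 : P c ≠ 0) (heq : P c' = P c) : P u = P c := by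
  by_contra hu
  -- Either `u` already has the other color or a trial gives it that color; both leave `u` with two
  -- neighbors of the opposite color.
  obtain ⟨Q, hPQ, hQ, hval⟩ : ∃ Q, Extends P Q ∧ IsConsistent G Q ∧ Q u ≠ 0 ∧ Q u ≠ P c := by
    by_cases hu0 : P u = 0
    · have hc2 := h.1 c
      obtain ⟨x, hx, hxc⟩ : ∃ x, (x = 1 ∨ x = 2) ∧ x ≠ P c := by
        by_cases h1 : P c = 1
        · exact ⟨2, Or.inr rfl, by omega⟩
        · exact ⟨1, Or.inl rfl, by omega⟩
      obtain ⟨Q, hQ, hQu, hQ'⟩ := h.2.2 u hu0 x hx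
      exact ⟨Q, hQ, hQ'.2, by omega, by omega⟩
    · exact ⟨P, Extends.refl P, h.2.1, hu0, hu⟩
  have e1 := hPQ c h0
  have e2 := hPQ c' (by rwa [heq])
  exact hne ((hQ u hval.1).2 c c' hc hc' (by rwa [e1]) (by rw [e1]; exact hval.2.symm)
    (by rwa [e2, heq]) (by rw [e2, heq]; exact hval.2.symm))

/-- A vertex with a neighbor of the other color passes its color to all other neighbors. -/
theorem IsClosed.eq_of_matched (h : IsClosed G 1 P) {c d u : V} (hc : P c ≠ 0) (hd : G.Adj c d)
    (hd0 : P d ≠ 0) (hdc : P d ≠ P c) (hu : G.Adj c u) (hud : u ≠ d) : P u = P c := by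
  by_contra hne
  obtain ⟨Q, hPQ, hQ, hval⟩ : ∃ Q, Extends P Q ∧ IsConsistent G Q ∧ Q u ≠ 0 ∧ Q u ≠ P c := by
    by_cases hu0 : P u = 0
    · have hc2 := h.1 c
      have hd2 := h.1 d
      obtain ⟨Q, hQ, hQu, hQ'⟩ := h.2.2 u hu0 (P d) (by omega)
      exact ⟨Q, hQ, hQ'.2, by omega, by omega⟩
    · exact ⟨P, Extends.refl P, h.2.1, hu0, hne⟩
  have e1 := hPQ c hc
  have e2 := hPQ d hd0
  exact hud ((hQ c (by rwa [e1])).2 u d hu hd hval.1 (by rw [e1]; exact hval.2) (by rwa [e2])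
    (by rwa [e1, e2]))

/-- If all neighbors of a colored vertex except for `u` are colored, then so is `u`. -/
theorem IsClosed.ne_zero_of_last (h : IsClosed G 1 P) {c u : V} (hc : P c ≠ 0) (hu : G.Adj c u)
    (hall : ∀ d, G.Adj c d → d ≠ u → P d ≠ 0) : P u ≠ 0 := by
  intro hu0
  have hc2 := h.1 c
  by_cases hex : ∃ d, G.Adj c d ∧ P d ≠ 0 ∧ P d ≠ P c
  · obtain ⟨d, hd, hd0, hdc⟩ := hex
    have := h.eq_of_matched hc hd hd0 hdc hu (by rintro rfl; exact hd0 hu0)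
    omega
  -- The other neighbors of `c` all share its color. A trial giving this color to `u` as well leaves
  -- `c` without a partner.
  · push Not at hex
    obtain ⟨Q, hPQ, hQu, hQ'⟩ := h.2.2 u hu0 (P c) (by omega)
    obtain ⟨⟨d, hd, hne⟩, -⟩ := hQ'.2 c (by rwa [hPQ c hc])
    apply hne
    rw [hPQ c hc]
    by_cases hdu : d = u
    · rw [hdu, hQu]
    · have hd0 := hall d hd hdu
      rw [hPQ d hd0]
      exact hex d hd hd0

theorem IsConsistent.not_all_eq (h : IsConsistent G P) {c : V} (hc : P c ≠ 0)
    (hall : ∀ d, G.Adj c d → P d = P c) : False := by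
  obtain ⟨⟨d, hd, hne⟩, -⟩ := h c hc
  exact hne (hall d hd)

/-- The reason for two rounds: the propagation rules need one round, and they still hold in the
coloring `Q` that results from a trial. -/
theorem IsClosed.exists_trial (h : IsClosed G 2 P) {u : V} (hu : P u = 0) {x : ℕ}
    (hx : x = 1 ∨ x = 2) : ∃ Q, IsClosed G 1 Q ∧ Extends P Q ∧ Q u = x := by
  obtain ⟨Q, hQ, hQu, hQ'⟩ := h.2.2 u hu x hx
  exact ⟨Q, hQ', hQ, hQu⟩

end Coloring

/-! #### Closed partial colorings whose uncolored part has no induced path on four vertices -/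

section Structure

variable {V : Type*}

/-- `a` is adjacent to all other vertices of its uncolored component, in which `b` has degree
one. -/
structure IsDominating (G : SimpleGraph V) (Q σ : V → ℕ) (a b : V) : Prop where
  left : Q a = 0
  right : Q b = 0
  adj : G.Adj a b
  pendant : ∀ z, Q z = 0 → G.Adj b z → z = a
  color : ∀ x, Q x = 0 → G.Adj a x → x ≠ b → σ x = σ a
  closed : ∀ x, Q x = 0 → G.Adj a x → ∀ z, Q z = 0 → G.Adj x z → z = a ∨ G.Adj a z

/-- The cycle `p q y x` is an uncolored component with matched pairs `p q` and `x y`. -/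
structure IsFourCycle (G : SimpleGraph V) (Q σ : V → ℕ) (p q x y : V) : Prop where
  zero_p : Q p = 0
  zero_q : Q q = 0
  zero_x : Q x = 0
  zero_y : Q y = 0
  adj_pq : G.Adj p q
  adj_px : G.Adj p x
  adj_qy : G.Adj q y
  adj_xy : G.Adj x y
  color_pq : σ p ≠ σ q
  color_x : σ x = σ p
  color_y : σ y = σ q
  nbr_p : ∀ z, Q z = 0 → G.Adj p z → z = q ∨ z = x
  nbr_q : ∀ z, Q z = 0 → G.Adj q z → z = p ∨ z = y
  nbr_x : ∀ z, Q z = 0 → G.Adj x z → z = p ∨ z = y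
  nbr_y : ∀ z, Q z = 0 → G.Adj y z → z = q ∨ z = x

variable {G : SimpleGraph V} {Q σ : V → ℕ}

theorem IsFourCycle.symm {p q x y : V} (h : IsFourCycle G Q σ p q x y) :
    IsFourCycle G Q σ x y p q where
  zero_p := h.zero_x
  zero_q := h.zero_y
  zero_x := h.zero_p
  zero_y := h.zero_q
  adj_pq := h.adj_xy
  adj_px := h.adj_px.symm
  adj_qy := h.adj_qy.symm
  adj_xy := h.adj_pq
  color_pq := by rw [h.color_x, h.color_y]; exact h.color_pq
  color_x := h.color_x.symm
  color_y := h.color_y.symm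
  nbr_p := fun z h0 hz => (h.nbr_x z h0 hz).symm
  nbr_q := fun z h0 hz => (h.nbr_y z h0 hz).symm
  nbr_x := fun z h0 hz => (h.nbr_p z h0 hz).symm
  nbr_y := fun z h0 hz => (h.nbr_q z h0 hz).symm

theorem IsFourCycle.swap {p q x y : V} (h : IsFourCycle G Q σ p q x y) :
    IsFourCycle G Q σ q p y x where
  zero_p := h.zero_q
  zero_q := h.zero_p
  zero_x := h.zero_y
  zero_y := h.zero_x
  adj_pq := h.adj_pq.symm
  adj_px := h.adj_qy
  adj_qy := h.adj_px
  adj_xy := h.adj_xy.symm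
  color_pq := h.color_pq.symm
  color_x := h.color_y
  color_y := h.color_x
  nbr_p := h.nbr_q
  nbr_q := h.nbr_p
  nbr_x := h.nbr_y
  nbr_y := h.nbr_x

/-- Hypotheses on the partial coloring `Q` reached by the algorithm on a yes-instance. -/
structure IsReduced (G : SimpleGraph V) (Q σ : V → ℕ) : Prop where
  perfect : IsPerfect G σ
  ext : Extends Q σ
  closed : IsClosed G 2 Q
  connected : G.Connected
  exists_colored : ∃ v, Q v ≠ 0
  no_path : ∀ a b c d, Q a = 0 → Q b = 0 → Q c = 0 → Q d = 0 → G.Adj a b → G.Adj b c → G.Adj c d →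
    a ≠ c → a ≠ d → b ≠ d → ¬ G.Adj a c → ¬ G.Adj a d → ¬ G.Adj b d → False

namespace IsReduced

variable (h : IsReduced G Q σ)
include h

theorem partner_unique {v w w' : V} (hw : G.Adj v w) (hw' : G.Adj v w') (hne : σ w ≠ σ v)
    (hne' : σ w' ≠ σ v) : w = w' :=
  (h.perfect.2 v).unique ⟨hw, hne⟩ ⟨hw', hne'⟩

theorem eq_of_ne_partner {v w w' : V} (hw : G.Adj v w) (hw' : G.Adj v w') (hne : σ w ≠ σ v)
    (hww : w' ≠ w) : σ w' = σ v := by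
  by_contra hne'
  exact hww (h.partner_unique hw' hw hne' hne)

theorem eq_of_ne {x y z : V} (h1 : σ x ≠ σ z) (h2 : σ y ≠ σ z) : σ x = σ y := by
  have := h.perfect.1 x
  have := h.perfect.1 y
  have := h.perfect.1 z
  omega

/-- The uncolored component of an edge with ends of different colors. -/
theorem structure_of_bichromatic {p q : V} (hp : Q p = 0) (hq : Q q = 0) (hpq : G.Adj p q)
    (hσ : σ p ≠ σ q) : IsDominating G Q σ p q ∨ IsDominating G Q σ q p ∨
      ∃ x y, IsFourCycle G Q σ p q x y := by
  -- Since `a` is the only uncolored neighbor of `b`, a vertex `z` reached from `a` only through `x`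
  -- would give the induced path `z x a b`.
  have dom : ∀ a b, Q a = 0 → Q b = 0 → G.Adj a b → σ a ≠ σ b →
      (∀ z, Q z = 0 → G.Adj b z → z = a) → IsDominating G Q σ a b := by
    intro a b ha hb hab hne hpend
    refine ⟨ha, hb, hab, hpend, fun x _ hax hxb => h.eq_of_ne_partner hab hax hne.symm hxb, ?_⟩
    intro x hx hax z hz hxz
    by_contra hcon
    push Not at hcon
    have hxb : x ≠ b := by
      rintro rfl
      exact hcon.1 (hpend z hz hxz)
    have hbx : ¬ G.Adj b x := fun hbx => hax.ne (hpend x hx hbx).symm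
    have hbz : ¬ G.Adj b z := fun hbz => hcon.1 (hpend z hz hbz)
    exact h.no_path z x a b hz hx ha hb hxz.symm hax.symm hab hcon.1
      (by rintro rfl; exact hcon.2 hab) hxb (fun e => hcon.2 e.symm) (fun e => hbz e.symm)
      (fun e => hbx e.symm)
  by_cases hp1 : ∀ z, Q z = 0 → G.Adj q z → z = p
  · exact Or.inl (dom p q hp hq hpq hσ hp1)
  by_cases hq1 : ∀ z, Q z = 0 → G.Adj p z → z = q
  · exact Or.inr (Or.inl (dom q p hq hp hpq.symm hσ.symm hq1))
  push Not at hp1 hq1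
  -- As `p` and `q` are partners, `x` has the color of `p` and `y` that of `q`, which excludes the
  -- edges `xq` and `py`. Without the edge `xy`, the path `x p q y` would be induced.
  have cross : ∀ x y, Q x = 0 → Q y = 0 → G.Adj p x → x ≠ q → G.Adj q y → y ≠ p → G.Adj x y := by
    intro x y hx hy hpx hxq hqy hyp
    by_contra hxy
    have hσx := h.eq_of_ne_partner hpq hpx hσ.symm hxq
    have hσy := h.eq_of_ne_partner hpq.symm hqy hσ hyp
    refine h.no_path x p q y hx hp hq hy hpx.symm hpq hqy hxq ?_ hyp.symm ?_ hxy ?_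
    · rintro rfl; exact hσ (hσx.symm.trans hσy)
    · exact fun e => hpx.ne (h.partner_unique hpq.symm e.symm hσ (by rw [hσx]; exact hσ))
    · exact fun e => hqy.ne (h.partner_unique hpq e hσ.symm (by rw [hσy]; exact hσ.symm))
  obtain ⟨y, hy, hqy, hyp⟩ := hp1
  obtain ⟨x, hx, hpx, hxq⟩ := hq1
  have hxy := cross x y hx hy hpx hxq hqy hyp
  have hσx := h.eq_of_ne_partner hpq hpx hσ.symm hxq
  have hσy := h.eq_of_ne_partner hpq.symm hqy hσ hyp
  -- A further neighbor `z` of `p` would, by `cross`, be a second neighbor of `y` of the other color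
  -- besides `x`.
  have hnp : ∀ z, Q z = 0 → G.Adj p z → z = q ∨ z = x := by
    intro z hz hpz
    by_contra! hcon
    have hzy := cross z y hz hy hpz hcon.1 hqy hyp
    have hσz := h.eq_of_ne_partner hpq hpz hσ.symm hcon.1
    exact hcon.2 (h.partner_unique hzy.symm hxy.symm (by rw [hσz, hσy]; exact hσ)
      (by rw [hσx, hσy]; exact hσ))
  have hnq : ∀ z, Q z = 0 → G.Adj q z → z = p ∨ z = y := by
    intro z hz hqz
    by_contra! hcon
    have hxz := cross x z hx hz hpx hxq hqz hcon.1
    have hσz := h.eq_of_ne_partner hpq.symm hqz hσ hcon.1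
    exact hcon.2 (h.partner_unique hxz hxy (by rw [hσz, hσx]; exact hσ.symm)
      (by rw [hσx, hσy]; exact hσ.symm))
  have hpy : p ≠ y := hyp.symm
  have npy : ¬ G.Adj p y := fun e => by
    rcases hnp y hy e with rfl | rfl
    · exact hqy.ne rfl
    · exact hxy.ne rfl
  have nqx : ¬ G.Adj q x := fun e => by
    rcases hnq x hx e with rfl | rfl
    · exact hpx.ne rfl
    · exact hxy.ne rfl
  -- A further neighbor `z` of `x` would start the induced path `z x p q`.
  have hnx : ∀ z, Q z = 0 → G.Adj x z → z = p ∨ z = y := by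
    intro z hz hxz
    by_contra! hcon
    have npz : ¬ G.Adj p z := fun e => by
      rcases hnp z hz e with rfl | rfl
      · exact nqx hxz.symm
      · exact hxz.ne rfl
    have nqz : ¬ G.Adj q z := fun e => by
      rcases hnq z hz e with rfl | rfl
      · exact hcon.1 rfl
      · exact hcon.2 rfl
    exact h.no_path z x p q hz hx hp hq hxz.symm hpx.symm hpq hcon.1
      (by rintro rfl; exact nqx hxz.symm) hxq (fun e => npz e.symm) (fun e => nqz e.symm)
      (fun e => nqx e.symm)
  have hny : ∀ z, Q z = 0 → G.Adj y z → z = q ∨ z = x := by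
    intro z hz hyz
    by_contra! hcon
    have npz : ¬ G.Adj p z := fun e => by
      rcases hnp z hz e with rfl | rfl
      · exact hcon.1 rfl
      · exact hcon.2 rfl
    have nqz : ¬ G.Adj q z := fun e => by
      rcases hnq z hz e with rfl | rfl
      · exact npy hyz.symm
      · exact hyz.ne rfl
    exact h.no_path z y q p hz hy hq hp hyz.symm hqy.symm hpq.symm hcon.1
      (by rintro rfl; exact npy hyz.symm) hyp (fun e => nqz e.symm) (fun e => npz e.symm)
      (fun e => npy e.symm)
  exact Or.inr (Or.inr ⟨x, y, hp, hq, hx, hy, hpq, hpx, hqy, hxy, hσ, hσx, hσy, hnp, hnq, hnx,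
    hny⟩)

theorem closed_one : IsClosed G 1 Q := h.closed.of_succ

theorem color_eq {c : V} (hc : Q c ≠ 0) : Q c = σ c := (h.ext c hc).symm

/-- A colored neighbor `c` of `p` has the color of `p`, because the partner of `p` is `q`. Try the
color of `q` on `p`: then `c` is the partner of `p`, so `q` and `x` receive the color of `q`, and so
does `y`, which sees both. All neighbors of `q` now share its color, a contradiction. -/
theorem uncolored_of_isFourCycle {p q x y : V} (hF : IsFourCycle G Q σ p q x y) (c : V)
    (hc : G.Adj p c) : Q c = 0 := by
  by_contra hc0
  have hcq : c ≠ q := by rintro rfl; exact hc0 hF.zero_q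
  have hQc : Q c = σ p := by
    rw [h.color_eq hc0]; exact h.eq_of_ne_partner hF.adj_pq hc hF.color_pq.symm hcq
  obtain ⟨R, hR, hQR, hRp⟩ := h.closed.exists_trial hF.zero_p (h.perfect.1 q)
  have hRc : R c = σ p := by rw [hQR c hc0, hQc]
  have hp0 : R p ≠ 0 := by rw [hRp]; exact h.perfect.ne_zero q
  have hm : ∀ u, G.Adj p u → u ≠ c → R u = σ q := fun u hu huc =>
    (hR.eq_of_matched hp0 hc (by rw [hRc]; exact h.perfect.ne_zero p)
      (by rw [hRc, hRp]; exact hF.color_pq) hu huc).trans hRp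
  have hRq : R q = σ q := hm q hF.adj_pq hcq.symm
  have hRx : R x = σ q := hm x hF.adj_px (by rintro rfl; exact hc0 hF.zero_x)
  have hqx : q ≠ x := by
    rintro rfl
    exact hF.color_pq hF.color_x.symm
  have hRy : R y = σ q :=
    (hR.eq_of_two hF.adj_qy.symm hF.adj_xy.symm hqx (by rw [hRq]; exact h.perfect.ne_zero q)
      (by rw [hRx, hRq])).trans hRq
  refine hR.isConsistent.not_all_eq (c := q) (by rw [hRq]; exact h.perfect.ne_zero q) ?_
  intro d hd
  rw [hRq]
  by_cases hd0 : Q d = 0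
  · rcases hF.nbr_q d hd0 hd with rfl | rfl
    · exact hRp
    · exact hRy
  · rw [hQR d hd0, h.color_eq hd0]
    exact h.eq_of_ne_partner hF.adj_pq.symm hd hF.color_pq (by rintro rfl; exact hd0 hF.zero_p)

/-- By the symmetries of the cycle none of its vertices has a colored neighbor, so it is a component
of `G`. But `G` is connected and contains a colored vertex. -/
theorem not_isFourCycle {p q x y : V} (hF : IsFourCycle G Q σ p q x y) : False := by
  have hp := h.uncolored_of_isFourCycle hF
  have hq := h.uncolored_of_isFourCycle hF.swap
  have hx := h.uncolored_of_isFourCycle hF.symm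
  have hy := h.uncolored_of_isFourCycle hF.symm.swap
  have key : ∀ v w, G.Reachable v w → (v = p ∨ v = q ∨ v = x ∨ v = y) →
      (w = p ∨ w = q ∨ w = x ∨ w = y) := by
    rintro v w ⟨W⟩
    induction W with
    | nil => exact id
    | cons hadj _ ih =>
      intro hv
      apply ih
      rcases hv with rfl | rfl | rfl | rfl
      · have := hF.nbr_p _ (hp _ hadj) hadj; tauto
      · have := hF.nbr_q _ (hq _ hadj) hadj; tauto
      · have := hF.nbr_x _ (hx _ hadj) hadj; tauto
      · have := hF.nbr_y _ (hy _ hadj) hadj; tauto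
  obtain ⟨v, hv⟩ := h.exists_colored
  rcases key p v (h.connected.preconnected p v) (Or.inl rfl) with rfl | rfl | rfl | rfl
  · exact hv hF.zero_p
  · exact hv hF.zero_q
  · exact hv hF.zero_x
  · exact hv hF.zero_y

theorem isDominating_or {p q : V} (hp : Q p = 0) (hq : Q q = 0) (hpq : G.Adj p q)
    (hσ : σ p ≠ σ q) : IsDominating G Q σ p q ∨ IsDominating G Q σ q p := by
  rcases h.structure_of_bichromatic hp hq hpq hσ with h1 | h1 | ⟨x, y, h1⟩
  · exact Or.inl h1
  · exact Or.inr h1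
  · exact (h.not_isFourCycle h1).elim

/-- In a dominated component, neither end of the matched edge has colored neighbors, and all other
vertices have colored neighbors of both colors. -/
theorem colored_of_isDominating {a b : V} (hD : IsDominating G Q σ a b) (hσ : σ a ≠ σ b) :
    (∀ c, G.Adj a c → Q c = 0) ∧ (∀ c, G.Adj b c → Q c = 0) ∧
      ∀ x, Q x = 0 → G.Adj a x → x ≠ b → ∀ z, z = 1 ∨ z = 2 → ∃ c, G.Adj x c ∧ Q c = z := by
  -- Apart from `b`, which is not adjacent to `x`, the whole component has the color of `a`; so the
  -- partner of `x` is outside the component and therefore colored.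
  have hx1 : ∀ x, Q x = 0 → G.Adj a x → x ≠ b → ∃ c, G.Adj x c ∧ Q c = σ b := by
    intro x hx hax hxb
    have hσx := hD.color x hx hax hxb
    obtain ⟨y, ⟨hxy, hyx⟩, -⟩ := h.perfect.2 x
    have hy0 : Q y ≠ 0 := by
      intro hy0
      rcases hD.closed x hx hax y hy0 hxy with rfl | hay
      · exact hyx hσx.symm
      · by_cases hyb : y = b
        · subst hyb
          exact hax.ne (hD.pendant x hx hxy.symm).symm
        · exact hyx ((hD.color y hy0 hay hyb).trans hσx.symm)
    exact ⟨y, hxy, by rw [h.color_eq hy0]; exact h.eq_of_ne hyx (by rw [hσx]; exact hσ.symm)⟩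
  have hbcol : ∀ c, G.Adj b c → Q c ≠ 0 → Q c = σ b := by
    intro c hc hc0
    rw [h.color_eq hc0]
    exact h.eq_of_ne_partner hD.adj.symm hc hσ (by rintro rfl; exact hc0 hD.left)
  have hσb0 := h.perfect.ne_zero b
  -- One trial serves all three claims: `a` receives the color of `b`, against `σ`.
  obtain ⟨R, hR, hQR, hRa⟩ := h.closed.exists_trial hD.left (h.perfect.1 b)
  have hRa0 : R a ≠ 0 := by rw [hRa]; exact hσb0
  have ha : ∀ c, G.Adj a c → Q c = 0 := by
    intro c hc
    by_contra hc0
    have hcb : c ≠ b := by rintro rfl; exact hc0 hD.right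
    have hQc : R c = σ a := by
      rw [hQR c hc0, h.color_eq hc0]; exact h.eq_of_ne_partner hD.adj hc hσ.symm hcb
    have hRb : R b = σ b := (hR.eq_of_matched hRa0 hc
      (by rw [hQc]; exact h.perfect.ne_zero a) (by rw [hQc, hRa]; exact hσ) hD.adj hcb.symm).trans
      hRa
    refine hR.isConsistent.not_all_eq (c := b) (by rw [hRb]; exact hσb0) fun d hd => ?_
    rw [hRb]
    by_cases hd0 : Q d = 0
    · rw [hD.pendant d hd0 hd, hRa]
    · rw [hQR d hd0, hbcol d hd hd0]
  have hRx : ∀ x, Q x = 0 → G.Adj a x → x ≠ b → R x = σ b := by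
    intro x hx hax hxb
    obtain ⟨c, hxc, hc⟩ := hx1 x hx hax hxb
    have hc0 : Q c ≠ 0 := by rw [hc]; exact hσb0
    exact (hR.eq_of_two hax.symm hxc (by rintro rfl; exact hc0 hD.left) hRa0
      (by rw [hQR c hc0, hc, hRa])).trans hRa
  have hb : ∀ c, G.Adj b c → Q c = 0 := by
    intro c hc
    by_contra hc0
    have hRb : R b = σ b := (hR.eq_of_two hD.adj.symm hc (by rintro rfl; exact hc0 hD.left) hRa0
      (by rw [hQR c hc0, hbcol c hc hc0, hRa])).trans hRa
    refine hR.isConsistent.not_all_eq (c := a) hRa0 fun d hd => ?_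
    rw [hRa]
    by_cases hdb : d = b
    · rw [hdb, hRb]
    · exact hRx d (ha d hd) hd hdb
  refine ⟨ha, hb, fun x hx hax hxb z hz => ?_⟩
  by_cases hzb : z = σ b
  · subst hzb; exact hx1 x hx hax hxb
  -- Here `z` is the color of `a`. Without a colored neighbor of that color, all neighbors of `x`
  -- would have the color of `b` in `R`, like `x` itself.
  by_contra hcon
  push Not at hcon
  have hRxb := hRx x hx hax hxb
  refine hR.isConsistent.not_all_eq (c := x) (by rw [hRxb]; exact hσb0) fun d hd => ?_
  rw [hRxb]
  by_cases hd0 : Q d = 0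
  · rcases hD.closed x hx hax d hd0 hd with rfl | had
    · exact hRa
    · refine hRx d hd0 had ?_
      rintro rfl
      exact hax.ne (hD.pendant x hx hd.symm).symm
  · rw [hQR d hd0]
    have := hcon d hd
    have := h.closed.isPartial d
    have := h.perfect.1 b
    omega

/-- An uncolored vertex with a colored neighbor has colored neighbors of both colors. -/
theorem exists_colored_nbr {u c : V} (hu : Q u = 0) (huc : G.Adj u c) (hc : Q c ≠ 0) {z : ℕ}
    (hz : z = 1 ∨ z = 2) : ∃ d, G.Adj u d ∧ Q d = z := by
  let E : V → V → Prop := fun v w => Q v = 0 ∧ G.Adj v w ∧ Q w = 0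
  have hE0 : ∀ v, Relation.ReflTransGen E u v → Q v = 0 := by
    intro v hv
    induction hv with
    | refl => exact hu
    | tail _ h1 _ => exact h1.2.2
  -- A bichromatic edge makes the component of `u` dominated; `u` is neither end of that edge,
  -- because the ends have no colored neighbors.
  by_cases hbi : ∃ p q, Relation.ReflTransGen E u p ∧ E p q ∧ σ p ≠ σ q
  · obtain ⟨p, q, hup, ⟨hp, hpq, hq⟩, hσ⟩ := hbi
    have main : ∀ a b, IsDominating G Q σ a b → σ a ≠ σ b → (p = a ∨ G.Adj a p) →
        ∃ d, G.Adj u d ∧ Q d = z := by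
      intro a b hD hne hpa
      obtain ⟨h1, h2, h3⟩ := h.colored_of_isDominating hD hne
      have hmem : u = a ∨ G.Adj a u := by
        clear hE0 hpq hσ hp hu huc
        induction hup using Relation.ReflTransGen.head_induction_on with
        | refl => exact hpa
        | head hE _ ih =>
          rcases ih with rfl | hE'
          · exact Or.inr hE.2.1.symm
          · exact hD.closed _ hE.2.2 hE' _ hE.1 hE.2.1.symm
      rcases hmem with rfl | hau
      · exact (hc (h1 c huc)).elim
      · by_cases hub : u = b
        · subst hub
          exact (hc (h2 c huc)).elim
        · exact h3 u hu hau hub z hz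
    rcases h.isDominating_or hp hq hpq hσ with hD | hD
    · exact main p q hD hσ (Or.inl rfl)
    · exact main q p hD hσ.symm (Or.inr hpq.symm)
  · push Not at hbi
    by_contra hcon
    push Not at hcon
    have hσu : ∀ v, Relation.ReflTransGen E u v → σ v = σ u := by
      intro v hv
      induction hv with
      | refl => rfl
      | tail h1 h2 ih => exact (hbi _ _ h1 h2).symm.trans ih
    -- Now `σ` is constant on the component of `u`, so all its vertices have colored partners.
    have hout : ∀ v, Relation.ReflTransGen E u v → ∃ d, G.Adj v d ∧ Q d ≠ 0 ∧ Q d ≠ σ u := by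
      intro v hv
      obtain ⟨d, ⟨hvd, hd⟩, -⟩ := h.perfect.2 v
      have hd0 : Q d ≠ 0 := fun hd0 => hd (hbi v d hv ⟨hE0 v hv, hvd, hd0⟩).symm
      exact ⟨d, hvd, hd0, by rw [h.color_eq hd0, ← hσu v hv]; exact hd⟩
    have hzu : z = σ u := by
      obtain ⟨d, hud, hd0, hd⟩ := hout u .refl
      have := hcon d hud
      have := h.closed.isPartial d
      have := h.perfect.1 u
      omega
    obtain ⟨y, hy, hyz⟩ : ∃ y, (y = 1 ∨ y = 2) ∧ y ≠ z := by
      rcases hz with rfl | rfl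
      · exact ⟨2, by simp⟩
      · exact ⟨1, by simp⟩
    have hfix : ∀ d, Q d ≠ 0 → Q d ≠ z → Q d = y := by
      intro d hd hdz
      have := h.closed.isPartial d
      omega
    -- The trial color `y` spreads over the component: the next vertex sees it on its predecessor
    -- and on its colored partner. In the end `u` has only neighbors of color `y`.
    obtain ⟨R, hR, hQR, hRu⟩ := h.closed.exists_trial hu hy
    have hRv : ∀ v, Relation.ReflTransGen E u v → R v = y := by
      intro v hv
      induction hv with
      | refl => exact hRu
      | tail h1 h2 ih =>
        rename_i v w
        obtain ⟨d, hwd, hd0, hd⟩ := hout w (h1.tail h2)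
        have hRd : R d = y := by rw [hQR d hd0]; exact hfix d hd0 (by rwa [hzu])
        exact (hR.eq_of_two h2.2.1.symm hwd (by rintro rfl; exact hd0 h2.1) (by rw [ih]; omega)
          (by rw [ih, hRd])).trans ih
    refine hR.isConsistent.not_all_eq (c := u) (by rw [hRu]; omega) fun d hd => ?_
    rw [hRu]
    by_cases hd0 : Q d = 0
    · exact hRv d (.single ⟨hu, hd, hd0⟩)
    · rw [hQR d hd0]; exact hfix d hd0 (hcon d hd)

end IsReduced

end Structure

/-! ### Counting at the boundary of the uncolored part, and gluing. -/

namespace IsReduced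

variable {V : Type*} {G : SimpleGraph V} {Q σ : V → ℕ}

/-- A colored vertex has at most two uncolored neighbors. -/
theorem eq_or_eq_of_uncolored [Finite V] (h : IsReduced G Q σ) {c u w v : V} (hc : Q c ≠ 0)
    (hu : Q u = 0) (hw : Q w = 0) (hv : Q v = 0) (hcu : G.Adj c u) (hcw : G.Adj c w)
    (hcv : G.Adj c v) (huw : u ≠ w) : v = u ∨ v = w := by
  classical
  have := Fintype.ofFinite V
  by_contra! hcon
  -- Double counting of the edges between `C` and `U`: there are at least two at each vertex of `C`
  -- and at most two at each vertex of `O`, none elsewhere in `U`, and `O.card ≤ C.card`. A third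
  -- uncolored neighbor of `c` makes the first bound strict.
  let C : Finset V := Finset.univ.filter fun c => Q c ≠ 0 ∧ ∃ u, G.Adj c u ∧ Q u = 0
  let U : Finset V := Finset.univ.filter fun u => Q u = 0
  let O : Finset V := U.filter fun u => ∃ c, G.Adj u c ∧ Q c ≠ 0
  have hC : ∀ c ∈ C, 2 ≤ (U.bipartiteAbove G.Adj c).card := by
    intro c hc
    obtain ⟨hc0, u, hcu, hu⟩ := (Finset.mem_filter.1 hc).2
    by_contra hlt
    refine h.closed_one.ne_zero_of_last hc0 hcu (fun d hd hdu hd0 => hlt ?_) hu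
    refine Finset.one_lt_card.2 ⟨u, ?_, d, ?_, hdu.symm⟩ <;>
      simp [Finset.bipartiteAbove, U, *]
  -- Two colored neighbors of the same color would have forced a color on `u`, so `Q` is injective
  -- on the colored neighbors.
  have hU : ∀ u ∈ U, (C.bipartiteBelow G.Adj u).card ≤ if u ∈ O then 2 else 0 := by
    intro u hu
    split_ifs with huO
    · refine (Finset.card_le_card_of_injOn (t := {1, 2}) Q ?_ ?_).trans Finset.card_le_two
      · intro c hc
        simp only [Finset.bipartiteBelow, Finset.coe_filter, C, Finset.mem_filter] at hc
        have := h.closed.isPartial c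
        have := hc.1.2.1
        simp only [Finset.coe_insert, Finset.coe_singleton, Set.mem_insert_iff,
          Set.mem_singleton_iff]
        omega
      · intro c hc d hd hcd
        simp only [Finset.bipartiteBelow, Finset.coe_filter, C, Finset.mem_filter] at hc hd
        by_contra hne
        have := h.closed_one.eq_of_two hc.2.symm hd.2.symm hne hc.1.2.1 hcd.symm
        exact hc.1.2.1 (this.symm.trans (Finset.mem_filter.1 hu).2)
    · rw [Nat.le_zero, Finset.card_eq_zero, Finset.eq_empty_iff_forall_notMem]
      intro c hc
      simp only [Finset.bipartiteBelow, C, Finset.mem_filter] at hc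
      exact huO (Finset.mem_filter.2 ⟨hu, c, hc.2.symm, hc.1.2.1⟩)
  -- Map each vertex of `O` to its partner: `u` has a colored neighbor of the color opposite to `σ
  -- u`, and by uniqueness that neighbor is the partner.
  have hO : O.card ≤ C.card := by
    choose f hf _ using h.perfect.2
    refine Finset.card_le_card_of_injOn f ?_ ?_
    · intro u hu
      obtain ⟨hu0, c, huc, hc⟩ := Finset.mem_filter.1 (Finset.mem_coe.1 hu)
      have hu0 := (Finset.mem_filter.1 hu0).2
      obtain ⟨z, hz, hzu⟩ : ∃ z, (z = 1 ∨ z = 2) ∧ z ≠ σ u := by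
        rcases h.perfect.1 u with h1 | h1
        · exact ⟨2, by simp [h1]⟩
        · exact ⟨1, by simp [h1]⟩
      obtain ⟨d, hud, hd⟩ := h.exists_colored_nbr hu0 huc hc hz
      have hd0 : Q d ≠ 0 := by omega
      have hfd : f u = d := h.partner_unique (hf u).1 hud (hf u).2
        (by rw [← h.color_eq hd0, hd]; exact hzu)
      simp only [C, Finset.coe_filter, Set.mem_ofPred_eq, Finset.mem_univ, true_and, hfd]
      exact ⟨hd0, u, hud.symm, hu0⟩
    · intro u _ u' _ he
      have h2 := hf u'
      rw [← he] at h2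
      exact h.partner_unique (hf u).1.symm h2.1.symm (hf u).2.symm h2.2.symm
  have hsum := Finset.sum_card_bipartiteAbove_eq_sum_card_bipartiteBelow (s := C) (t := U) G.Adj
  have h1 : ∑ u ∈ U, (C.bipartiteBelow G.Adj u).card ≤ 2 * O.card := by
    refine (Finset.sum_le_sum hU).trans ?_
    rw [← Finset.sum_filter, Finset.sum_const, smul_eq_mul, mul_comm]
    exact Nat.mul_le_mul_left _ (Finset.card_le_card fun u hu => (Finset.mem_filter.1 hu).2)
  have h2 : ∑ _c ∈ C, 2 < ∑ c ∈ C, (U.bipartiteAbove G.Adj c).card := by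
    refine Finset.sum_lt_sum hC ⟨c, ?_, ?_⟩
    · simp only [C, Finset.mem_filter, Finset.mem_univ, true_and]
      exact ⟨hc, u, hcu, hu⟩
    · refine Finset.two_lt_card.2 ⟨u, ?_, w, ?_, v, ?_, huw, hcon.1.symm, hcon.2.symm⟩ <;>
        simp [Finset.bipartiteAbove, U, *]
  rw [Finset.sum_const, smul_eq_mul] at h2
  omega

/-- A closed extension colors, with an uncolored vertex, all its neighbors. -/
theorem ne_zero_of_adj (h : IsReduced G Q σ) {R : V → ℕ} (hR : IsClosed G 1 R)
    (hQR : Extends Q R) {u w : V} (hu : Q u = 0) (hRu : R u ≠ 0) (hw : Q w = 0)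
    (huw : G.Adj u w) : R w ≠ 0 := by
  -- If `u` has colored neighbors, one differs from `R u`, so `u` is matched and passes its color to
  -- `w`. If `w` has colored neighbors, one has color `R u`, so `w` sees this color twice.
  have main : ∀ u w, Q u = 0 → R u ≠ 0 → Q w = 0 → G.Adj u w →
      ((∃ c, G.Adj u c ∧ Q c ≠ 0) ∨ ∃ c, G.Adj w c ∧ Q c ≠ 0) → R w ≠ 0 := by
    rintro u w hu hRu hw huw (⟨c, huc, hc⟩ | ⟨c, hwc, hc⟩)
    · obtain ⟨z, hz, hzu⟩ : ∃ z, (z = 1 ∨ z = 2) ∧ z ≠ R u := by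
        by_cases h1 : R u = 1
        · exact ⟨2, by simp [h1]⟩
        · exact ⟨1, by omega⟩
      obtain ⟨d, hud, hd⟩ := h.exists_colored_nbr hu huc hc hz
      have hd0 : Q d ≠ 0 := by omega
      have hRd := hQR d hd0
      rw [hR.eq_of_matched hRu hud (by omega) (by omega) huw (by rintro rfl; exact hd0 hw)]
      exact hRu
    · have := hR.isPartial u
      obtain ⟨d, hwd, hd⟩ := h.exists_colored_nbr hw hwc hc (z := R u) (by omega)
      have hd0 : Q d ≠ 0 := by omega
      have hRd := hQR d hd0
      rw [hR.eq_of_two huw.symm hwd (by rintro rfl; exact hd0 hu) hRu (by omega)]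
      exact hRu
  by_cases hex : (∃ c, G.Adj u c ∧ Q c ≠ 0) ∨ ∃ c, G.Adj w c ∧ Q c ≠ 0
  · exact main u w hu hRu hw huw hex
  push Not at hex
  by_cases hσ : σ u = σ w
  -- The partner `p` of `u` is uncolored, so the component is dominated. If `u` dominates, then `w`
  -- has colored neighbors; if `u` is pendant, then `w` is `p`.
  · exfalso
    obtain ⟨p, ⟨hup, hp⟩, -⟩ := h.perfect.2 u
    rcases h.isDominating_or hu (hex.1 p hup) hup hp.symm with hD | hD
    · obtain ⟨c, hwc, hc⟩ := (h.colored_of_isDominating hD hp.symm).2.2 w hw huw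
        (by rintro rfl; exact hp hσ.symm) 1 (Or.inl rfl)
      have := hex.2 c hwc
      omega
    · have := hD.pendant w hw huw
      subst this
      exact hp hσ.symm
  -- Now `u` and `w` are partners. Any other neighbor of `u` exists only if `u` dominates; it then
  -- has colored neighbors and is colored by `main`, so `w` is the last one.
  · refine hR.ne_zero_of_last hRu huw fun d hd hdw => ?_
    have hd0 := hex.1 d hd
    rcases h.isDominating_or hu hw huw hσ with hD | hD
    · obtain ⟨c, hdc, hc⟩ := (h.colored_of_isDominating hD hσ).2.2 d hd0 hd hdw 1 (Or.inl rfl)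
      exact main u d hu hRu hd0 hd (Or.inr ⟨c, hdc, by omega⟩)
    · exact (hdw (hD.pendant d hd0 hd)).elim

/-- Closed extensions of a reduced partial coloring extend to perfect colorings. -/
theorem exists_perfect [Finite V] (h : IsReduced G Q σ) {R : V → ℕ} (hR : IsClosed G 1 R)
    (hQR : Extends Q R) : ∃ τ, IsPerfect G τ ∧ Extends R τ := by
  classical
  let τ : V → ℕ := fun v => if R v ≠ 0 then R v else σ v
  have hτR : ∀ v, R v ≠ 0 → τ v = R v := fun v hv => by simp [τ, hv]
  have hτσ : ∀ v, (Q v = 0 → R v = 0) → τ v = σ v := by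
    intro v hv
    by_cases hRv : R v = 0
    · simp [τ, hRv]
    · have hQv : Q v ≠ 0 := fun e => hRv (hv e)
      rw [hτR v hRv, hQR v hQv, h.color_eq hQv]
  refine ⟨τ, ⟨fun v => ?_, fun v => ?_⟩, hτR⟩
  · by_cases hRv : R v = 0
    · simpa [τ, hRv] using h.perfect.1 v
    · rw [hτR v hRv]
      have := hR.isPartial v
      omega
  -- On the closed neighborhood of `v`, `τ` agrees entirely with `R` or entirely with `σ`. If `v` is
  -- colored and `R` colors one of its at most two uncolored neighbors, the other one follows as the
  -- last neighbor.
  have hall : (R v ≠ 0 ∧ ∀ w, G.Adj v w → R w ≠ 0) ∨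
      ((Q v = 0 → R v = 0) ∧ ∀ w, G.Adj v w → Q w = 0 → R w = 0) := by
    by_cases hv : Q v = 0
    · by_cases hRv : R v = 0
      · refine Or.inr ⟨fun _ => hRv, fun w hvw hw => ?_⟩
        by_contra hRw
        exact h.ne_zero_of_adj hR hQR hw hRw hv hvw.symm hRv
      · refine Or.inl ⟨hRv, fun w hvw => ?_⟩
        by_cases hw : Q w = 0
        · exact h.ne_zero_of_adj hR hQR hv hRv hw hvw
        · rwa [hQR w hw]
    · have hRv : R v ≠ 0 := by rwa [hQR v hv]
      by_cases hex : ∃ u, G.Adj v u ∧ Q u = 0 ∧ R u ≠ 0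
      · obtain ⟨u, hvu, hu, hRu⟩ := hex
        refine Or.inl ⟨hRv, fun w hvw hRw => ?_⟩
        have hw : Q w = 0 := by
          by_contra hw
          exact hw (by rw [← hQR w hw, hRw])
        refine hR.ne_zero_of_last hRv hvw (fun d hd hdw => ?_) hRw
        by_cases hd0 : Q d = 0
        · rcases h.eq_or_eq_of_uncolored hv hu hw hd0 hvu hvw hd
            (by rintro rfl; exact hRu hRw) with rfl | rfl
          · exact hRu
          · exact (hdw rfl).elim
        · rwa [hQR d hd0]
      · push Not at hex
        exact Or.inr ⟨fun e => (hv e).elim, hex⟩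
  rcases hall with ⟨hRv, hw⟩ | ⟨hv, hw⟩
  · obtain ⟨⟨d, hvd, hd⟩, huniq⟩ := hR.isConsistent v hRv
    rw [hτR v hRv]
    refine ⟨d, ⟨hvd, by rwa [hτR d (hw d hvd)]⟩, fun y hy => ?_⟩
    have hy0 := hw y hy.1
    exact huniq y d hy.1 hvd hy0 (by rw [← hτR y hy0]; exact hy.2) (hw d hvd) hd
  · obtain ⟨d, ⟨hvd, hd⟩, huniq⟩ := h.perfect.2 v
    rw [hτσ v hv]
    refine ⟨d, ⟨hvd, by rwa [hτσ d (hw d hvd)]⟩, fun y hy => huniq y ⟨hy.1, ?_⟩⟩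
    rw [← hτσ y (hw y hy.1)]
    exact hy.2

end IsReduced

/-! ### Programs for partial colorings -/

open ForProg RamExpr

/-- Register `0` holds the number of vertices of `G`, and bank `0` its adjacency matrix. -/
structure HoldsGraph {n : ℕ} (G : SimpleGraph (Fin n)) (s : RamState) : Prop where
  size : s.reg 0 = n
  adj : ∀ i j : Fin n, s.bank 0 ((i : ℕ) * n + j) ≠ 0 ↔ G.Adj i j

/-- The coloring stored in a bank. -/
def coloring (n : ℕ) (s : RamState) (b : ℕ) : Fin n → ℕ := fun v => s.bank b v

theorem coloring_congr {n b : ℕ} {s s' : RamState} (h : s'.bank b = s.bank b) :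
    coloring n s' b = coloring n s b := by
  funext v; simp [coloring, h]

theorem HoldsGraph.of_eq {n : ℕ} {G : SimpleGraph (Fin n)} {s s' : RamState} (h : HoldsGraph G s)
    (h0 : s'.reg 0 = s.reg 0) (h1 : s'.bank 0 = s.bank 0) : HoldsGraph G s' :=
  ⟨h0.trans h.size, by rw [h1]; exact h.adj⟩

theorem HoldsGraph.run {n : ℕ} {G : SimpleGraph (Fin n)} {s : RamState} (h : HoldsGraph G s)
    {P : ForProg} (hP : P.WellFormed) (hP' : ¬ P.WritesBank 0) : HoldsGraph G (P.run s) :=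
  h.of_eq (run_reg_of_not_writes hP.not_writesReg_zero s) (run_bank_of_not_writes hP' s)

theorem coloring_setCell {n : ℕ} (s : RamState) (b : ℕ) (v : Fin n) (x : ℕ) :
    coloring n (s.setCell b v x) b = Function.update (coloring n s b) v x := by
  funext w
  simp [coloring, RamState.setCell_bank, Function.update_apply, Fin.ext_iff]

/-- Expression that is non-zero if and only if `e` and `f` have different values. -/
def neExpr (e f : RamExpr) : RamExpr := .add (.sub e f) (.sub f e)

theorem eval_neExpr (s : RamState) (e f : RamExpr) :
    (neExpr e f).eval s ≠ 0 ↔ e.eval s ≠ f.eval s := by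
  simp only [neExpr, RamExpr.eval]; omega

theorem card_filter_lt_succ {n k : ℕ} (hk : k < n) (p : Fin n → Prop) [DecidablePred p] :
    (Finset.univ.filter fun d : Fin n => (d : ℕ) < k + 1 ∧ p d).card =
      (Finset.univ.filter fun d : Fin n => (d : ℕ) < k ∧ p d).card +
        if p ⟨k, hk⟩ then 1 else 0 := by
  split_ifs with h
  · rw [← Finset.card_insert_of_notMem (a := (⟨k, hk⟩ : Fin n)) (by simp)]
    congr 1
    ext d
    simp only [Finset.mem_filter, Finset.mem_univ, true_and, Finset.mem_insert, Fin.ext_iff]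
    constructor
    · rintro ⟨h1, h2⟩
      by_cases hd : (d : ℕ) = k
      · exact Or.inl hd
      · exact Or.inr ⟨by omega, h2⟩
    · rintro (h1 | h1)
      · have : d = ⟨k, hk⟩ := Fin.ext h1
        subst this
        exact ⟨by simp, h⟩
      · exact ⟨by omega, h1.2⟩
  · rw [add_zero]
    congr 1
    ext d
    simp only [Finset.mem_filter, Finset.mem_univ, true_and]
    refine and_congr_left fun h2 => ?_
    have : (d : ℕ) ≠ k := by
      rintro rfl
      exact h h2
    omega

theorem exists_lt_succ {n k : ℕ} (hk : k < n) (p : Fin n → Prop) :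
    (∃ d : Fin n, (d : ℕ) < k + 1 ∧ p d) ↔ (∃ d : Fin n, (d : ℕ) < k ∧ p d) ∨ p ⟨k, hk⟩ := by
  constructor
  · rintro ⟨d, hd, h⟩
    by_cases hdk : (d : ℕ) = k
    · subst hdk; exact Or.inr h
    · exact Or.inl ⟨d, by omega, h⟩
  · rintro (⟨d, hd, h⟩ | h)
    · exact ⟨d, by omega, h⟩
    · exact ⟨_, by simp, h⟩

/-! #### Copying a bank -/

/-- Copy the coloring in bank `a` to bank `b`. -/
def copyBank (a b : ℕ) : ForProg := each 10 (put b (.var 10) (.get a (.var 10)))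

theorem copyBank_wellFormed (a b : ℕ) : (copyBank a b).WellFormed := by
  simp [copyBank, WellFormed, WritesReg]

theorem copyBank_writesReg {a b y : ℕ} (h : (copyBank a b).WritesReg y) : y = 10 ∨ y = 11 := by
  simpa [copyBank, WritesReg] using h

theorem copyBank_writesBank {a b c : ℕ} (h : (copyBank a b).WritesBank c) : c = b := by
  simpa [copyBank, WritesBank] using h

theorem coloring_copyBank {n a b : ℕ} {s : RamState} (hs : s.reg 0 = n) (hab : a ≠ b) :
    coloring n ((copyBank a b).run s) b = coloring n s a := by
  have := run_each_induct (copyBank_wellFormed a b) hs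
    (fun k s' => ∀ v : Fin n, (v : ℕ) < k → s'.bank b v = s.bank a v)
    (fun k s' v w h => by simpa using h) (fun v hv => absurd hv (Nat.not_lt_zero _)) ?_
  · funext v
    exact this v v.2
  · intro k s' hk _ hb hx _ hInv v hv
    have ha : s'.bank a = s.bank a := hb a (by simpa [WritesBank] using hab)
    simp only [run, RamExpr.eval, RamState.setCell_bank, hx, ha, true_and]
    split_ifs with h
    · rw [h]
    · exact hInv v (by omega)

/-! #### Consistency check -/

/-- Body of the loop over the neighbors in `checkBank`. -/
def countNbr (b : ℕ) : ForProg :=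
  ite (.get 0 (.add (.var 5) (.var 6)))
    (ite (neExpr (.get b (.var 6)) (.get b (.var 4)))
      (seq (assign 8 (.const 1))
        (ite (.get b (.var 6)) (assign 9 (.add (.var 9) (.const 1))) skip)) skip) skip

/-- Set register `2` to a non-zero value if and only if the coloring in bank `b` is consistent. -/
def checkBank (b : ℕ) : ForProg :=
  -- Register `4` holds the vertex, `5` its row offset, `6` the candidate neighbor. Register `8`
  -- flags a neighbor with a different value, and `9` counts the colored neighbors among these.
  seq (assign 2 (.const 1)) (each 4 (ite (.get b (.var 4))
    (seq (assign 8 (.const 0)) (seq (assign 9 (.const 0)) (seq (each 6 (countNbr b))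
      -- Non-zero exactly if register `8` is zero or register `9` exceeds one.
      (ite (.add (.sub (.const 1) (.var 8)) (.sub (.var 9) (.const 1)))
        (assign 2 (.const 0)) skip)))) skip))

theorem countNbr_writesReg {b y : ℕ} : (countNbr b).WritesReg y ↔ y = 8 ∨ y = 9 := by
  simp [countNbr, WritesReg]

theorem countNbr_wellFormed (b : ℕ) : (each 6 (countNbr b)).WellFormed := by
  simp [countNbr, WellFormed, WritesReg]

theorem checkBank_wellFormed (b : ℕ) : (checkBank b).WellFormed := by
  simp [checkBank, countNbr, WellFormed, WritesReg]

theorem checkBank_writesReg {b y : ℕ} (h : (checkBank b).WritesReg y) :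
    y = 2 ∨ 4 ≤ y ∧ y < 10 := by
  simp only [checkBank, countNbr, WritesReg, or_false] at h
  omega

theorem checkBank_not_writesBank (b c : ℕ) : ¬ (checkBank b).WritesBank c := by
  simp [checkBank, countNbr, WritesBank]

open Classical in
theorem run_each_countNbr {n : ℕ} {G : SimpleGraph (Fin n)} {s : RamState} (hG : HoldsGraph G s)
    {b : ℕ} {c : Fin n} (h4 : s.reg 4 = c) (h5 : s.reg 5 = c * n) (h8 : s.reg 8 = 0)
    (h9 : s.reg 9 = 0) {P : Fin n → ℕ} (hP : coloring n s b = P) :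
    (((each 6 (countNbr b)).run s).reg 8 ≠ 0 ↔ ∃ d, G.Adj c d ∧ P d ≠ P c) ∧
    ((each 6 (countNbr b)).run s).reg 9 =
      (Finset.univ.filter fun d => G.Adj c d ∧ P d ≠ P c ∧ P d ≠ 0).card := by
  have := run_each_induct (countNbr_wellFormed b) hG.size
    (fun k s' => (s'.reg 8 ≠ 0 ↔ ∃ d : Fin n, (d : ℕ) < k ∧ G.Adj c d ∧ P d ≠ P c) ∧
      s'.reg 9 = (Finset.univ.filter fun d : Fin n =>
        (d : ℕ) < k ∧ G.Adj c d ∧ P d ≠ P c ∧ P d ≠ 0).card)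
    (fun k s' v w h => by simpa using h) (by simp [h8, h9]) ?_
  · simpa using this
  · rintro k s' hk hreg hbank h6 _ ⟨hI1, hI2⟩
    have e4 : s'.reg 4 = c := (hreg 4 (by simp) (by simp) (by simp [countNbr_writesReg])).trans h4
    have e5 : s'.reg 5 = c * n :=
      (hreg 5 (by simp) (by simp) (by simp [countNbr_writesReg])).trans h5
    have eb : ∀ a, s'.bank a = s.bank a := fun a => hbank a (by simp [countNbr, WritesBank])
    have hPk : s.bank b k = P ⟨k, hk⟩ := by rw [← hP]; rfl
    have hPc : s.bank b c = P c := by rw [← hP]; rfl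
    have hA : s.bank 0 (c * n + k) ≠ 0 ↔ G.Adj c ⟨k, hk⟩ := hG.adj c ⟨k, hk⟩
    have hne : (neExpr (.get b (.var 6)) (.get b (.var 4))).eval s' ≠ 0 ↔ P ⟨k, hk⟩ ≠ P c := by
      rw [eval_neExpr]; simp [RamExpr.eval, h6, e4, eb, hPk, hPc]
    have hA' : (RamExpr.get 0 (.add (.var 5) (.var 6))).eval s' ≠ 0 ↔ G.Adj c ⟨k, hk⟩ := by
      simp only [RamExpr.eval, h6, e5, eb]; exact hA
    have h0 : ∀ v, (RamExpr.get b (.var 6)).eval (s'.setReg 8 v) = P ⟨k, hk⟩ := by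
      intro v; simp [RamExpr.eval, h6, eb, hPk]
    rw [exists_lt_succ hk, card_filter_lt_succ hk]
    simp only [countNbr, run, hA', hne, h0]
    by_cases hadj : G.Adj c ⟨k, hk⟩
    · by_cases hdiff : P ⟨k, hk⟩ ≠ P c
      · by_cases hz : P ⟨k, hk⟩ ≠ 0
        · simp [hadj, hdiff, hz, RamExpr.eval, hI2]
        · simp [hadj, hdiff, hz, RamExpr.eval, hI2]
      · simpa [hadj, hdiff] using ⟨hI1, hI2⟩
    · simpa [hadj] using ⟨hI1, hI2⟩

theorem run_checkBank {n : ℕ} {G : SimpleGraph (Fin n)} {s : RamState} (hG : HoldsGraph G s)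
    (b : ℕ) : ((checkBank b).run s).reg 2 ≠ 0 ↔ IsConsistent G (coloring n s b) := by
  classical
  set P := coloring n s b with hP
  have hw := (checkBank_wellFormed b).2
  have hnb : ∀ a, ¬ (checkBank b).WritesBank a := checkBank_not_writesBank b
  have hsize : (s.setReg 2 1).reg 0 = n := by simpa using hG.size
  have := run_each_induct hw hsize
    (fun k s' => (s'.reg 2 ≠ 0 ↔ ∀ c : Fin n, (c : ℕ) < k → P c ≠ 0 →
      (∃ d, G.Adj c d ∧ P d ≠ P c) ∧ ∀ d d', G.Adj c d → G.Adj c d' →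
        P d ≠ 0 → P d ≠ P c → P d' ≠ 0 → P d' ≠ P c → d = d'))
    (fun k s' v w h => by simpa using h) (by simp) ?_
  · refine Iff.trans this ?_
    simp [IsConsistent]
  · intro k s' hk hreg hbank h4 h5 hInv
    have eb : ∀ a, s'.bank a = s.bank a := fun a => hbank a (by
      simpa [checkBank, WritesBank] using hnb a)
    have e0 : s'.reg 0 = s.reg 0 := by
      rw [hreg 0 (by simp) (by simp) (by simp [WritesReg, countNbr]), hsize, hG.size]
    have hPk : s'.bank b k = P ⟨k, hk⟩ := by rw [eb]; rfl
    have hsucc : ∀ p : Fin n → Prop, (∀ c : Fin n, (c : ℕ) < k + 1 → p c) ↔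
        (∀ c : Fin n, (c : ℕ) < k → p c) ∧ p ⟨k, hk⟩ := by
      intro p
      have := not_congr (exists_lt_succ hk fun c => ¬ p c)
      push Not at this
      exact this
    rw [hsucc, ← hInv]
    simp only [run, RamExpr.eval, h4, hPk]
    by_cases hz : P ⟨k, hk⟩ = 0
    · simp [hz]
    · have hG' : HoldsGraph G ((s'.setReg 8 0).setReg 9 0) :=
        hG.of_eq (by simpa using e0) (by simp [eb])
      obtain ⟨h8, h9⟩ := run_each_countNbr hG' (b := b) (c := ⟨k, hk⟩) (P := P) (by simp [h4])
        (by simp [h5]) (by simp) (by simp) (by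
          rw [hP]; exact coloring_congr (by simp [eb]))
      have e2 : ((each 6 (countNbr b)).run ((s'.setReg 8 0).setReg 9 0)).reg 2 = s'.reg 2 := by
        rw [run_reg_of_not_writes (by simp [WritesReg, countNbr])]; simp
      set s'' := (each 6 (countNbr b)).run ((s'.setReg 8 0).setReg 9 0) with hs''
      have huniq : s''.reg 9 ≤ 1 ↔ ∀ d d', G.Adj ⟨k, hk⟩ d → G.Adj ⟨k, hk⟩ d' →
          P d ≠ 0 → P d ≠ P ⟨k, hk⟩ → P d' ≠ 0 → P d' ≠ P ⟨k, hk⟩ → d = d' := by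
        rw [h9, Finset.card_le_one]
        simp only [Finset.mem_filter, Finset.mem_univ, true_and]
        constructor
        · intro H d d' h1 h2 h3 h4 h5 h6
          exact H d ⟨h1, h4, h3⟩ d' ⟨h2, h6, h5⟩
        · intro H d hd d' hd'
          exact H d d' hd.1 hd'.1 hd.2.2 hd.2.1 hd'.2.2 hd'.2.1
      have hrun : (each 6 (countNbr b)).run
          ((s'.setReg 8 0).setReg 9 0) = s'' := rfl
      simp only [run] at hrun
      simp only [hz, ne_eq, not_false_eq_true, if_true, hrun, true_implies]
      rw [← huniq, ← h8]
      split_ifs with hif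
      · rw [e2]
        constructor
        · intro h; exact ⟨h, by omega, by omega⟩
        · exact fun h => h.1
      · simp only [RamState.setReg_reg, if_true]
        constructor
        · intro h; exact (h trivial).elim
        · rintro ⟨-, h, h'⟩; omega

/-! #### Lookahead -/

/-- `Q` extends `P` and lies below all closed extensions of `P`, and it is closed itself if it is
consistent. -/
structure Refines {n : ℕ} (G : SimpleGraph (Fin n)) (i : ℕ) (P Q : Fin n → ℕ) : Prop where
  isPartial : IsPartial Q
  ext : Extends P Q
  least : ∀ R, IsClosed G i R → Extends P R → Extends Q R
  closed : IsConsistent G Q → IsClosed G i Q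

theorem Refines.apply_eq {n : ℕ} {G : SimpleGraph (Fin n)} {i : ℕ} {P Q : Fin n → ℕ} {v : Fin n}
    {x : ℕ} (h : Refines G i (Function.update P v x) Q) (hx : x ≠ 0) : Q v = x := by
  rw [h.ext v (by simpa using hx), Function.update_self]

/-- The uncolored vertices admit both colors in closed extensions. -/
def IsOpenBelow {n : ℕ} (G : SimpleGraph (Fin n)) (i k : ℕ) (P : Fin n → ℕ) : Prop :=
  ∀ v : Fin n, (v : ℕ) < k → P v = 0 → ∀ x, x = 1 ∨ x = 2 →
    ∃ Q, Extends P Q ∧ Q v = x ∧ IsClosed G i Q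

/-- Copy bank `a` to bank `b`, color the vertex in register `u` with color `x` there, run `R`, and
check consistency of bank `b`. -/
def trial (a b u x : ℕ) (R : ForProg) : ForProg :=
  seq (copyBank a b) (seq (put b (.var u) (.const x)) (seq R (checkBank b)))

/-- If the vertex in register `u` is not colored in bank `a` and one of the colors fails, give it
the other color. -/
def lookahead (a b u : ℕ) (R : ForProg) : ForProg :=
  ite (.get a (.var u)) skip (seq (trial a b u 1 R)
    (ite (.var 2) (seq (trial a b u 2 R) (ite (.var 2) skip (put a (.var u) (.const 1))))
      (put a (.var u) (.const 2))))

/-- Closure of the coloring in bank `i + 1` under `i` rounds of lookahead. -/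
def refine : ℕ → ForProg
  | 0 => skip
  -- Level `i + 1` has its own four registers from `12 + 4 * i` on and runs its trials in bank `i +
  -- 1`, which the lower level refines. The outer loop repeats the pass `n` times, since a pass that
  -- changes the coloring colors at least one vertex.
  | i + 1 => each (12 + 4 * i) (each (14 + 4 * i)
      (lookahead (i + 2) (i + 1) (14 + 4 * i) (refine i)))

/-! ### Registers and banks touched by the lookahead programs. -/

theorem trial_writesReg {a b u x : ℕ} {R : ForProg} {y : ℕ} (h : (trial a b u x R).WritesReg y) :
    y = 2 ∨ 4 ≤ y ∧ y < 12 ∨ R.WritesReg y := by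
  simp only [trial, WritesReg, false_or] at h
  rcases h with h | h | h
  · have := copyBank_writesReg h; omega
  · exact Or.inr (Or.inr h)
  · have := checkBank_writesReg h; omega

theorem trial_writesBank {a b u x : ℕ} {R : ForProg} {c : ℕ} (h : (trial a b u x R).WritesBank c) :
    c = b ∨ R.WritesBank c := by
  simp only [trial, WritesBank] at h
  rcases h with h | h | h | h
  · exact Or.inl (copyBank_writesBank h)
  · exact Or.inl h
  · exact Or.inr h
  · exact (checkBank_not_writesBank _ _ h).elim

theorem trial_wellFormed {a b u x : ℕ} {R : ForProg} (hR : R.WellFormed) :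
    (trial a b u x R).WellFormed :=
  ⟨copyBank_wellFormed a b, trivial, hR, checkBank_wellFormed b⟩

theorem lookahead_writesReg {a b u : ℕ} {R : ForProg} {y : ℕ}
    (h : (lookahead a b u R).WritesReg y) : y = 2 ∨ 4 ≤ y ∧ y < 12 ∨ R.WritesReg y := by
  simp only [lookahead, WritesReg, or_false, false_or] at h
  rcases h with h | h <;> exact trial_writesReg h

theorem lookahead_writesBank {a b u : ℕ} {R : ForProg} {c : ℕ}
    (h : (lookahead a b u R).WritesBank c) : c = a ∨ c = b ∨ R.WritesBank c := by
  simp only [lookahead, WritesBank, false_or] at h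
  rcases h with h | (h | h) | h
  · exact Or.inr (trial_writesBank h)
  · exact Or.inr (trial_writesBank h)
  · exact Or.inl h
  · exact Or.inl h

theorem lookahead_wellFormed {a b u : ℕ} {R : ForProg} (hR : R.WellFormed) :
    (lookahead a b u R).WellFormed :=
  ⟨trivial, trial_wellFormed hR, ⟨trial_wellFormed hR, trivial, trivial⟩, trivial⟩

theorem refine_writesReg {i y : ℕ} (h : (refine i).WritesReg y) :
    y = 2 ∨ 4 ≤ y ∧ y < 12 + 4 * i := by
  induction i with
  | zero => exact h.elim
  | succ i ih =>
    simp only [refine, WritesReg] at h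
    rcases h with h | h | h | h | h
    · omega
    · omega
    · omega
    · omega
    · rcases lookahead_writesReg h with h | h | h
      · omega
      · omega
      · have := ih h; omega

theorem refine_writesBank {i c : ℕ} (h : (refine i).WritesBank c) : 1 ≤ c ∧ c ≤ i + 1 := by
  induction i with
  | zero => exact h.elim
  | succ i ih =>
    rcases lookahead_writesBank h with h | h | h
    · omega
    · omega
    · have := ih h; omega

theorem refine_wellFormed (i : ℕ) : (refine i).WellFormed := by
  induction i with
  | zero => trivial
  | succ i ih =>
    have key : ∀ y, 12 + 4 * i ≤ y → ¬ (lookahead (i + 2) (i + 1) (14 + 4 * i)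
        (refine i)).WritesReg y := by
      intro y hy h
      rcases lookahead_writesReg h with h | h | h
      · omega
      · omega
      · have := refine_writesReg h; omega
    have k1 := key (12 + 4 * i)
    have k2 := key (12 + 4 * i + 1)
    have k3 := key (14 + 4 * i)
    have k4 := key (14 + 4 * i + 1)
    refine ⟨by omega, ?_, ?_, by omega, k3 (by omega), k4 (by omega), lookahead_wellFormed ih⟩ <;>
    · simp only [WritesReg, not_or]
      exact ⟨by omega, by omega, by first | exact k1 (by omega) | exact k2 (by omega)⟩

theorem IsPartial.update {n : ℕ} {P : Fin n → ℕ} (h : IsPartial P) (v : Fin n) {x : ℕ}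
    (hx : x ≤ 2) : IsPartial (Function.update P v x) := by
  intro w
  by_cases hw : w = v
  · subst hw; simpa using hx
  · rw [Function.update_of_ne hw]; exact h w

section

variable {n : ℕ} {G : SimpleGraph (Fin n)} {i a b u : ℕ} {R : ForProg}

/-- Effect of a trial. -/
theorem run_trial (hab : a ≠ b) (hb : b ≠ 0) (hR : R.WellFormed) (hR0 : ¬ R.WritesBank 0)
    (hspec : ∀ s, HoldsGraph G s → IsPartial (coloring n s b) →
      Refines G i (coloring n s b) (coloring n (R.run s) b))
    (hu : 12 ≤ u) {s : RamState} (hG : HoldsGraph G s) {v : Fin n} (hv : s.reg u = v) {x : ℕ}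
    (hx : x ≤ 2) (hP : IsPartial (coloring n s a)) :
    ∃ Q, Refines G i (Function.update (coloring n s a) v x) Q ∧
      coloring n ((trial a b u x R).run s) b = Q ∧
      (((trial a b u x R).run s).reg 2 ≠ 0 ↔ IsConsistent G Q) := by
  set s₁ := (copyBank a b).run s with hs₁
  have hG₁ : HoldsGraph G s₁ := hG.run (copyBank_wellFormed a b) fun h =>
    hb (copyBank_writesBank h).symm
  have hc₁ : coloring n s₁ b = coloring n s a := coloring_copyBank hG.size hab
  have hu₁ : s₁.reg u = v := by
    rw [hs₁, run_reg_of_not_writes, hv]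
    intro h
    have := copyBank_writesReg h
    omega
  set s₂ := s₁.setCell b v x with hs₂
  have hG₂ : HoldsGraph G s₂ := hG₁.of_eq rfl (RamState.setCell_bank_of_ne _ _ _ hb.symm)
  have hc₂ : coloring n s₂ b = Function.update (coloring n s a) v x := by
    rw [hs₂, coloring_setCell, hc₁]
  have hQ := hspec s₂ hG₂ (by rw [hc₂]; exact hP.update v hx)
  rw [hc₂] at hQ
  have hG₃ : HoldsGraph G (R.run s₂) := hG₂.run hR hR0
  have hrun : (trial a b u x R).run s = (checkBank b).run (R.run s₂) := by
    simp only [trial, run, RamExpr.eval]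
    rw [← hs₁, hu₁]
  refine ⟨_, hQ, ?_, ?_⟩
  · rw [hrun]
    exact coloring_congr (run_bank_of_not_writes (checkBank_not_writesBank _ _) _)
  · rw [hrun, run_checkBank hG₃]

/-- Effect of a lookahead. -/
theorem run_lookahead (hab : a ≠ b) (hb : b ≠ 0) (hR : R.WellFormed)
    (hR0 : ¬ R.WritesBank 0) (hRa : ¬ R.WritesBank a)
    (hspec : ∀ s, HoldsGraph G s → IsPartial (coloring n s b) →
      Refines G i (coloring n s b) (coloring n (R.run s) b))
    (hu : 12 ≤ u) (hRu : ¬ R.WritesReg u) {s : RamState} (hG : HoldsGraph G s) {v : Fin n}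
    (hv : s.reg u = v) (hP : IsPartial (coloring n s a)) :
    (∃ y, (y = 1 ∨ y = 2) ∧ coloring n s a v = 0 ∧
      coloring n ((lookahead a b u R).run s) a = Function.update (coloring n s a) v y ∧
      ∀ T, IsClosed G (i + 1) T → Extends (coloring n s a) T → T v = y) ∨
    coloring n ((lookahead a b u R).run s) a = coloring n s a ∧
      (coloring n s a v = 0 → ∀ x, x = 1 ∨ x = 2 →
        ∃ Q, Extends (coloring n s a) Q ∧ Q v = x ∧ IsClosed G i Q) := by
  -- If `T v ≠ y`, then `T` itself or an extension granted by its closedness gives `v` the color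
  -- `x`. It lies above `Q` by leastness and is consistent, so `Q` would be consistent too.
  have hfail : ∀ x y Q, (x = 1 ∧ y = 2 ∨ x = 2 ∧ y = 1) →
      Refines G i (Function.update (coloring n s a) v x) Q → ¬ IsConsistent G Q →
      ∀ T, IsClosed G (i + 1) T → Extends (coloring n s a) T → T v = y := by
    intro x y Q hxy hQ hcon T hT hPT
    by_contra hTv
    have hTv2 := hT.isPartial v
    apply hcon
    by_cases hT0 : T v = 0
    · obtain ⟨Q', hTQ, hQv, hQ'⟩ := hT.2.2 v hT0 x (by omega)
      exact hQ'.isConsistent.of_extends (hQ.least Q' hQ' ((hPT.trans hTQ).update hQv))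
    · exact hT.isConsistent.of_extends (hQ.least T hT.of_succ (hPT.update (by omega)))
  have hRa' : ∀ x, ¬ (trial a b u x R).WritesBank a := fun x h => by
    rcases trial_writesBank h with h | h
    · exact hab h
    · exact hRa h
  have hR0' : ∀ x, ¬ (trial a b u x R).WritesBank 0 := fun x h => by
    rcases trial_writesBank h with h | h
    · exact hb h.symm
    · exact hR0 h
  have hRu' : ∀ x, ¬ (trial a b u x R).WritesReg u := fun x h => by
    rcases trial_writesReg h with h | h | h
    · omega
    · omega
    · exact hRu h
  have hget : (RamExpr.get a (.var u)).eval s = coloring n s a v := by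
    simp [RamExpr.eval, hv, coloring]
  by_cases hz : coloring n s a v = 0
  swap
  · right
    refine ⟨?_, fun h => (hz h).elim⟩
    simp only [lookahead, run, hget, ne_eq, hz, not_false_eq_true, if_true]
  obtain ⟨Q₁, hQ₁, -, hr₁⟩ := run_trial hab hb hR hR0 hspec hu hG hv (x := 1) (by omega) hP
  set s₁ := (trial a b u 1 R).run s with hs₁
  have hG₁ : HoldsGraph G s₁ := hG.run (trial_wellFormed hR) (hR0' 1)
  have hc₁ : coloring n s₁ a = coloring n s a := coloring_congr (run_bank_of_not_writes (hRa' 1) s)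
  have hv₁ : s₁.reg u = v := (run_reg_of_not_writes (hRu' 1) s).trans hv
  obtain ⟨Q₂, hQ₂, -, hr₂⟩ := run_trial hab hb hR hR0 hspec hu hG₁ hv₁ (x := 2) le_rfl
    (by rw [hc₁]; exact hP)
  set s₂ := (trial a b u 2 R).run s₁ with hs₂
  have hc₂ : coloring n s₂ a = coloring n s a :=
    (coloring_congr (run_bank_of_not_writes (hRa' 2) s₁)).trans hc₁
  have hv₂ : s₂.reg u = v := (run_reg_of_not_writes (hRu' 2) s₁).trans hv₁
  rw [hc₁] at hQ₂
  have hz' : ¬ (RamExpr.get a (.var u)).eval s ≠ 0 := not_not.2 (hget.trans hz)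
  have hrun : (lookahead a b u R).run s = if s₁.reg 2 ≠ 0 then
      (if s₂.reg 2 ≠ 0 then s₂ else s₂.setCell a v 1) else s₁.setCell a v 2 := by
    rw [lookahead, run, if_neg hz']
    simp only [run, RamExpr.eval]
    rw [← hs₁, ← hs₂, hv₁, hv₂]
    by_cases h1 : s₁.reg 2 = 0 <;> by_cases h2 : s₂.reg 2 = 0 <;> simp [h1, h2]
  by_cases h1 : s₁.reg 2 ≠ 0
  · by_cases h2 : s₂.reg 2 ≠ 0
    · right
      rw [hrun, if_pos h1, if_pos h2]
      refine ⟨hc₂, fun _ x hx => ?_⟩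
      rcases hx with rfl | rfl
      · exact ⟨Q₁, (extends_update hz 1).trans hQ₁.ext, hQ₁.apply_eq (by simp),
          hQ₁.closed (hr₁.1 h1)⟩
      · exact ⟨Q₂, (extends_update hz 2).trans hQ₂.ext, hQ₂.apply_eq (by simp),
          hQ₂.closed (hr₂.1 h2)⟩
    · left
      rw [hrun, if_pos h1, if_neg h2]
      exact ⟨1, Or.inl rfl, hz, by rw [coloring_setCell, hc₂],
        hfail 2 1 Q₂ (by omega) hQ₂ fun h => h2 (hr₂.2 h)⟩
  · left
    rw [hrun, if_neg h1]
    exact ⟨2, Or.inr rfl, hz, by rw [coloring_setCell, hc₁],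
      hfail 1 2 Q₁ (by omega) hQ₁ fun h => h1 (hr₁.2 h)⟩

/-- Effect of one pass of lookaheads over all vertices. -/
theorem run_each_lookahead (hw : (each u (lookahead a b u R)).WellFormed) (hab : a ≠ b)
    (ha : a ≠ 0) (hb : b ≠ 0) (hR : R.WellFormed)
    (hR0 : ¬ R.WritesBank 0) (hRa : ¬ R.WritesBank a)
    (hspec : ∀ s, HoldsGraph G s → IsPartial (coloring n s b) →
      Refines G i (coloring n s b) (coloring n (R.run s) b))
    (hu : 12 ≤ u) (hRu : ¬ R.WritesReg u) {s : RamState} (hG : HoldsGraph G s)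
    {P Q : Fin n → ℕ} (hP : coloring n s a = P) (hQ : coloring n
      ((each u (lookahead a b u R)).run s) a = Q) (hP2 : IsPartial P) :
    IsPartial Q ∧ Extends P Q ∧ (∀ T, IsClosed G (i + 1) T → Extends P T → Extends Q T) ∧
      (Q = P → IsOpenBelow G i n P) := by
  have := run_each_induct hw hG.size
    (fun k s' => IsPartial (coloring n s' a) ∧ Extends P (coloring n s' a) ∧
      (∀ T, IsClosed G (i + 1) T → Extends P T → Extends (coloring n s' a) T) ∧
      (coloring n s' a = P → IsOpenBelow G i k P))
    (fun k s v w h => h) ?_ ?_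
  · rw [hQ] at this
    exact this
  · rw [hP]
    exact ⟨hP2, Extends.refl P, fun T _ h => h, fun _ v hv => absurd hv (Nat.not_lt_zero _)⟩
  · rintro k s' hk hreg hbank hx - ⟨hI1, hI2, hI3, hI4⟩
    have hG' : HoldsGraph G s' := by
      refine hG.of_eq (hreg 0 (by omega) (by omega) (hw.2.2.2.not_writesReg_zero)) (hbank 0 ?_)
      intro h
      rcases lookahead_writesBank h with h | h | h
      · exact ha h.symm
      · exact hb h.symm
      · exact hR0 h
    rcases run_lookahead hab hb hR hR0 hRa hspec hu hRu hG' (v := ⟨k, hk⟩) hx hI1 with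
      ⟨y, hy, hz, hc, hT⟩ | ⟨hc, hopen⟩
    · rw [hc]
      refine ⟨hI1.update _ (by omega), hI2.trans (extends_update hz y), fun T hT1 hPT => ?_,
        fun heq => ?_⟩
      · have hext := hI3 T hT1 hPT
        exact hext.update (hT T hT1 hext)
      -- This pass has just colored a vertex that `P` leaves uncolored, so the result differs from
      -- `P`.
      · exfalso
        have h1 := congrFun heq ⟨k, hk⟩
        rw [Function.update_self] at h1
        have h2 := hI2 ⟨k, hk⟩ (by omega)
        omega
    · rw [hc]
      refine ⟨hI1, hI2, hI3, fun heq v hv h0 x hx => ?_⟩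
      by_cases hvk : (v : ℕ) = k
      · have : v = ⟨k, hk⟩ := Fin.ext hvk
        subst this
        rw [heq] at hopen
        exact hopen h0 x hx
      · exact hI4 heq v (by omega) h0 x hx

end

theorem Extends.antisymm {V : Type*} {P Q : V → ℕ} (h : Extends P Q) (h' : Extends Q P) :
    P = Q := by
  funext v
  by_cases hv : P v = 0
  · by_contra hne
    have := h' v (by omega)
    omega
  · exact (h v hv).symm

theorem card_zero_lt_of_extends {n : ℕ} {P Q : Fin n → ℕ} (h : Extends P Q) (hne : Q ≠ P) :
    (Finset.univ.filter fun v => Q v = 0).card < (Finset.univ.filter fun v => P v = 0).card := by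
  refine Finset.card_lt_card ⟨fun v hv => ?_, fun hsub => hne ?_⟩
  · simp only [Finset.mem_filter, Finset.mem_univ, true_and] at hv ⊢
    by_contra h0
    exact h0 (by rw [← h v h0, hv])
  · funext v
    by_cases hv : P v = 0
    · have := hsub (Finset.mem_filter.2 ⟨Finset.mem_univ v, hv⟩)
      rw [(Finset.mem_filter.1 this).2, hv]
    · exact h v hv

/-- Effect of `refine`. -/
theorem run_refine {n : ℕ} {G : SimpleGraph (Fin n)} (i : ℕ) : ∀ s, HoldsGraph G s →
    IsPartial (coloring n s (i + 1)) →
    Refines G i (coloring n s (i + 1)) (coloring n ((refine i).run s) (i + 1)) := by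
  induction i with
  | zero => exact fun s _ hP => ⟨hP, Extends.refl _, fun R _ h => h, fun h => ⟨hP, h⟩⟩
  | succ i ih =>
    intro s hG hP
    have hw := refine_wellFormed (i + 1)
    have hwi := refine_wellFormed i
    have hnb : ∀ c, ¬ (1 ≤ c ∧ c ≤ i + 1) → ¬ (refine i).WritesBank c :=
      fun c hc h => hc (refine_writesBank h)
    set P := coloring n s (i + 2) with hPdef
    have hclosed : ∀ Q, IsPartial Q → IsOpenBelow G i n Q → IsConsistent G Q →
        IsClosed G (i + 1) Q :=
      fun Q h1 h2 h3 => ⟨h1, h3, fun v hv x hx => h2 v v.2 hv x hx⟩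
    -- After `k` passes at least `k` vertices are colored, or the coloring is closed unless it is
    -- inconsistent. After `n` passes the first case leaves no vertex to test.
    have := run_each_induct hw hG.size
      (fun k s' => IsPartial (coloring n s' (i + 2)) ∧ Extends P (coloring n s' (i + 2)) ∧
        (∀ T, IsClosed G (i + 1) T → Extends P T → Extends (coloring n s' (i + 2)) T) ∧
        ((Finset.univ.filter fun v => coloring n s' (i + 2) v = 0).card + k ≤ n ∨
          (IsConsistent G (coloring n s' (i + 2)) → IsClosed G (i + 1) (coloring n s' (i + 2)))))
      (fun k s v w h => h) ?_ ?_
    · obtain ⟨h1, h2, h3, h4⟩ := this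
      refine ⟨h1, h2, h3, ?_⟩
      rcases h4 with h4 | h4
      · intro hcon
        refine hclosed _ h1 (fun v _ hv => ?_) hcon
        have : v ∈ Finset.univ.filter fun v =>
            coloring n ((refine (i + 1)).run s) (i + 2) v = 0 := by simpa using hv
        have := Finset.card_pos.2 ⟨v, this⟩
        rw [refine] at this
        omega
      · exact h4
    · refine ⟨hP, Extends.refl P, fun T _ h => h, Or.inl ?_⟩
      simpa using Finset.card_filter_le (Finset.univ : Finset (Fin n)) _
    · rintro k s' hk hreg hbank - - ⟨h1, h2, h3, h4⟩
      have hG' : HoldsGraph G s' := by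
        refine hG.of_eq (hreg 0 (by omega) (by omega) (hw.2.2.2.not_writesReg_zero)) (hbank 0 ?_)
        intro h
        have : (refine (i + 1)).WritesBank 0 := h
        have := refine_writesBank this
        omega
      set P' := coloring n s' (i + 2) with hP'
      obtain ⟨g1, g2, g3, g4⟩ := run_each_lookahead hw.2.2.2 (by omega) (by omega) (by omega) hwi
        (hnb 0 (by omega)) (hnb (i + 2) (by omega)) ih (by omega)
        (fun h => by have := refine_writesReg h; omega) hG' rfl rfl h1
      set Q := coloring n ((each (14 + 4 * i) (lookahead (i + 2) (i + 1) (14 + 4 * i)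
        (refine i))).run s') (i + 2) with hQ
      rw [← hP'] at g2 g3 g4
      refine ⟨g1, h2.trans g2, fun T hT hPT => g3 T hT (h3 T hT hPT), ?_⟩
      by_cases hQP : Q = P'
      · right
        rw [hQP]
        exact hclosed P' h1 (g4 hQP)
      · rcases h4 with h4 | h4
        · left
          have := card_zero_lt_of_extends g2 hQP
          omega
        · right
          -- If the result `Q` is consistent, so is `P'`, which is then closed; by `g3` it extends
          -- `Q`, so the two agree.
          intro hcon
          have hc := h4 (hcon.of_extends g2)
          rw [← g2.antisymm (g3 P' hc (Extends.refl P'))]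
          exact hc

/-! #### Greedy completion -/

/-- Color the vertices one after the other in bank `4`, with color `1` whenever this does not fail
after two rounds of lookahead. -/
def greedy : ForProg :=
  each 20 (ite (.get 4 (.var 20)) skip (seq (trial 4 3 20 1 (refine 2))
    (ite (.var 2) (put 4 (.var 20) (.const 1)) (put 4 (.var 20) (.const 2)))))

theorem greedy_writesReg {y : ℕ} (h : greedy.WritesReg y) : y = 2 ∨ 4 ≤ y ∧ y < 22 := by
  simp only [greedy, WritesReg, or_false, false_or] at h
  rcases h with h | h | h
  · omega
  · omega
  · rcases trial_writesReg h with h | h | h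
    · omega
    · omega
    · have := refine_writesReg h; omega

theorem greedy_writesBank {c : ℕ} (h : greedy.WritesBank c) : 1 ≤ c := by
  simp only [greedy, WritesBank, false_or] at h
  rcases h with h | h | h
  · rcases trial_writesBank h with h | h
    · omega
    · exact (refine_writesBank h).1
  · omega
  · omega

theorem greedy_wellFormed : greedy.WellFormed := by
  have key : ∀ y, 20 ≤ y → ¬ (trial 4 3 20 1 (refine 2)).WritesReg y := by
    intro y hy h
    rcases trial_writesReg h with h | h | h
    · omega
    · omega
    · have := refine_writesReg h; omega
  have h20 := key 20 (by omega)
  have h21 := key 21 (by omega)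
  exact ⟨by omega, by simp [WritesReg, h20], by simp [WritesReg, h21], trivial,
    trial_wellFormed (refine_wellFormed 2), trivial, trivial⟩

/-- The result is total in any case. If all closed extensions below a perfect coloring are reduced,
the loop preserves the existence of a perfect extension, which at the end must be the result itself.
-/
theorem run_greedy {n : ℕ} {G : SimpleGraph (Fin n)} {s : RamState} (hG : HoldsGraph G s)
    {P Q : Fin n → ℕ} (hP : coloring n s 4 = P) (hP2 : IsPartial P)
    (hQ : coloring n (greedy.run s) 4 = Q) :
    IsPartial Q ∧ (∀ v, Q v ≠ 0) ∧
      ((∀ R σ, Extends P R → IsPerfect G σ → Extends R σ → IsClosed G 2 R → IsReduced G R σ) →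
        (∃ σ, IsPerfect G σ ∧ Extends P σ) → IsPerfect G Q) := by
  have := run_each_induct greedy_wellFormed hG.size
    (fun k s' => IsPartial (coloring n s' 4) ∧ Extends P (coloring n s' 4) ∧
      (∀ v : Fin n, (v : ℕ) < k → coloring n s' 4 v ≠ 0) ∧
      ((∀ R σ, Extends P R → IsPerfect G σ → Extends R σ → IsClosed G 2 R → IsReduced G R σ) →
        (∃ σ, IsPerfect G σ ∧ Extends P σ) → ∃ σ, IsPerfect G σ ∧ Extends (coloring n s' 4) σ))
    (fun k s v w h => h) ?_ ?_
  · have hrun : coloring n ((each 20 _).run s) 4 = Q := hQ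
    rw [hrun] at this
    obtain ⟨h1, -, h3, h4⟩ := this
    refine ⟨h1, fun v => h3 v v.2, fun hyp hex => ?_⟩
    obtain ⟨σ, hσ, hQσ⟩ := h4 hyp hex
    have : σ = Q := funext fun v => hQσ v (h3 v v.2)
    exact this ▸ hσ
  · rw [hP]
    exact ⟨hP2, Extends.refl P, fun v hv => absurd hv (Nat.not_lt_zero _), fun _ h => h⟩
  · rintro k s' hk hreg hbank hx - ⟨h1, h2, h3, h4⟩
    have hw := greedy_wellFormed
    have hG' : HoldsGraph G s' := by
      refine hG.of_eq (hreg 0 (by omega) (by omega) hw.2.2.2.not_writesReg_zero) (hbank 0 ?_)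
      intro h
      have : greedy.WritesBank 0 := h
      have := greedy_writesBank this
      omega
    set v : Fin n := ⟨k, hk⟩ with hv
    set C := coloring n s' 4 with hC
    have hget : (RamExpr.get 4 (.var 20)).eval s' = C v := by simp [RamExpr.eval, hx, hC, coloring,
      hv]
    by_cases hz : C v = 0
    swap
    · have hcond : (RamExpr.get 4 (.var 20)).eval s' ≠ 0 := by rwa [hget]
      rw [run, if_pos hcond]
      refine ⟨h1, h2, fun w hw => ?_, h4⟩
      by_cases hwk : (w : ℕ) = k
      · have : w = v := Fin.ext hwk
        rwa [this]
      · exact h3 w (by omega)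
    · have hcond : ¬ (RamExpr.get 4 (.var 20)).eval s' ≠ 0 := by rw [hget]; exact not_not.2 hz
      have hnb : ∀ c, ¬ (1 ≤ c ∧ c ≤ 3) → ¬ (refine 2).WritesBank c :=
        fun c hc h => hc (refine_writesBank h)
      obtain ⟨R, hR, -, hr⟩ := run_trial (a := 4) (b := 3) (by omega) (by omega)
        (refine_wellFormed 2) (hnb 0 (by omega)) (run_refine (G := G) 2) (u := 20) (by omega) hG'
        (v := v) hx (x := 1) (by omega) h1
      set s₁ := (trial 4 3 20 1 (refine 2)).run s' with hs₁
      have hc₁ : coloring n s₁ 4 = C := by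
        refine coloring_congr (run_bank_of_not_writes ?_ s')
        intro h
        rcases trial_writesBank h with h | h
        · omega
        · have := refine_writesBank h; omega
      have hx₁ : s₁.reg 20 = v := by
        rw [hs₁, run_reg_of_not_writes, hx]
        intro h
        rcases trial_writesReg h with h | h | h
        · omega
        · omega
        · have := refine_writesReg h; omega
      obtain ⟨x, hx2, hx0, hres, hcol⟩ : ∃ x, x ≤ 2 ∧ x ≠ 0 ∧
          (ite (.get 4 (.var 20)) skip (seq (trial 4 3 20 1 (refine 2))
            (ite (.var 2) (put 4 (.var 20) (.const 1)) (put 4 (.var 20) (.const 2))))).run s' =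
            s₁.setCell 4 v x ∧ (x = 1 ∧ IsConsistent G R ∨ x = 2 ∧ ¬ IsConsistent G R) := by
        by_cases hcon : s₁.reg 2 ≠ 0
        · refine ⟨1, by omega, by omega, ?_, Or.inl ⟨rfl, hr.1 hcon⟩⟩
          rw [run, if_neg hcond, run, ← hs₁, run,
            if_pos (show (RamExpr.var 2).eval s₁ ≠ 0 from hcon), run]
          simp only [RamExpr.eval, hx₁]
        · refine ⟨2, by omega, by omega, ?_, Or.inr ⟨rfl, fun h => hcon (hr.2 h)⟩⟩
          rw [run, if_neg hcond, run, ← hs₁, run,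
            if_neg (show ¬ (RamExpr.var 2).eval s₁ ≠ 0 from hcon), run]
          simp only [RamExpr.eval, hx₁]
      rw [hres, coloring_setCell, hc₁]
      refine ⟨h1.update v hx2, h2.trans (extends_update hz x), fun w hw => ?_, fun hyp hex => ?_⟩
      · by_cases hwk : w = v
        · rw [hwk, Function.update_self]; exact hx0
        · rw [Function.update_of_ne hwk]
          have : (w : ℕ) ≠ k := fun h => hwk (Fin.ext h)
          exact h3 w (by omega)
      · obtain ⟨σ, hσ, hCσ⟩ := h4 hyp hex
        have hσc : ∀ i, IsClosed G i σ := by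
          intro i
          have h2 : IsPartial σ := fun v => by rcases hσ.1 v with h | h <;> omega
          cases i with
          | zero => exact ⟨h2, hσ.isConsistent⟩
          | succ i => exact ⟨h2, hσ.isConsistent, fun u hu => (hσ.ne_zero u hu).elim⟩
        rcases hcol with ⟨rfl, hcon⟩ | ⟨rfl, hcon⟩
        -- The closure `Q` of the current coloring lies below `σ` and is therefore reduced. The
        -- closure `R` of the successful trial extends `Q`, so `exists_perfect` supplies a possibly
        -- different perfect coloring.
        · obtain ⟨Q, hQ⟩ : ∃ Q, Refines G 2 C Q := by
            have hcp : coloring n ((copyBank 4 3).run s') 3 = C :=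
              coloring_copyBank hG'.size (by omega)
            have hr := run_refine (G := G) 2 ((copyBank 4 3).run s')
              (hG'.run (copyBank_wellFormed _ _) fun h => by
                have := copyBank_writesBank h; omega) (by rw [hcp]; exact h1)
            rw [hcp] at hr
            exact ⟨_, hr⟩
          have hQσ := hQ.least σ (hσc 2) hCσ
          have hred := hyp Q σ (h2.trans hQ.ext) hσ hQσ
            (hQ.closed (hσ.isConsistent.of_extends hQσ))
          have hRc := hR.closed hcon
          have hQR := hQ.least R hRc ((extends_update hz 1).trans hR.ext)
          obtain ⟨τ, hτ, hRτ⟩ := hred.exists_perfect hRc.of_succ hQR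
          exact ⟨τ, hτ, hR.ext.trans hRτ⟩
        -- The failed trial excludes color `1` at `v` for every perfect extension, so `σ` itself
        -- survives.
        · refine ⟨σ, hσ, hCσ.update ?_⟩
          by_contra hσv
          have hσ1 : σ v = 1 := (hσ.1 v).resolve_right hσv
          exact hcon (hσ.isConsistent.of_extends (hR.least σ (hσc 2) (hCσ.update hσ1)))

/-! ### Search over tuples of vertices -/

/-- Run `B` for all `k`-tuples of vertices, in registers `30, 32, …`. -/
def forTuples (B : ForProg) : ℕ → ForProg
  | 0 => B
  | k + 1 => each (30 + 2 * k) (forTuples B k)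

theorem forTuples_writesReg {B : ForProg} {k y : ℕ} (h : (forTuples B k).WritesReg y) :
    B.WritesReg y ∨ 30 ≤ y ∧ y < 30 + 2 * k := by
  induction k with
  | zero => exact Or.inl h
  | succ k ih =>
    rcases h with h | h | h
    · omega
    · omega
    · rcases ih h with h | h
      · exact Or.inl h
      · omega

theorem forTuples_writesBank {B : ForProg} {k c : ℕ} (h : (forTuples B k).WritesBank c) :
    B.WritesBank c := by
  induction k with
  | zero => exact h
  | succ k ih => exact ih h

theorem forTuples_wellFormed {B : ForProg} (hB : B.WellFormed)
    (hB' : ∀ y, B.WritesReg y → y < 30) (k : ℕ) : (forTuples B k).WellFormed := by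
  induction k with
  | zero => exact hB
  | succ k ih =>
    have key : ∀ y, 30 + 2 * k ≤ y → ¬ (forTuples B k).WritesReg y := by
      intro y hy h
      rcases forTuples_writesReg h with h | h
      · have := hB' y h; omega
      · omega
    exact ⟨by omega, key _ le_rfl, key _ (by omega), ih⟩

/-- Specification of the body of a search over `m`-tuples: register `1` is set to a non-zero value
on the tuples that satisfy `p`, and never if `q` is false. -/
def IsSearchBody {n : ℕ} (G : SimpleGraph (Fin n)) (B : ForProg) (m : ℕ) (p : (ℕ → ℕ) → Prop)
    (q : Prop) : Prop :=
  ∀ s, HoldsGraph G s →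
    (∀ i, i < m → s.reg (30 + 2 * i) < n ∧ s.reg (31 + 2 * i) = s.reg (30 + 2 * i) * n) →
    (s.reg 1 ≠ 0 → (B.run s).reg 1 ≠ 0) ∧
    (p (fun i => s.reg (30 + 2 * i)) → (B.run s).reg 1 ≠ 0) ∧
    ((B.run s).reg 1 ≠ 0 → s.reg 1 ≠ 0 ∨ q)

/-- Induction on the nesting depth: the `k` inner loops range over the first `k` entries, while the
later entries are those currently in the registers. The flag in register `1` is never reset, so one
successful tuple suffices. -/
theorem run_forTuples {n : ℕ} {G : SimpleGraph (Fin n)} {B : ForProg} (hB : B.WellFormed)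
    (hB' : ∀ y, B.WritesReg y → y < 30) (hB0 : ¬ B.WritesBank 0) {m : ℕ} {p : (ℕ → ℕ) → Prop}
    {q : Prop} (hspec : IsSearchBody G B m p q) (k : ℕ) : ∀ s, HoldsGraph G s →
    (∀ i, k ≤ i → i < m → s.reg (30 + 2 * i) < n ∧
      s.reg (31 + 2 * i) = s.reg (30 + 2 * i) * n) →
    (s.reg 1 ≠ 0 → ((forTuples B k).run s).reg 1 ≠ 0) ∧
    (∀ t : ℕ → ℕ, (∀ i, i < k → t i < n) → (∀ i, k ≤ i → t i = s.reg (30 + 2 * i)) → p t →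
      ((forTuples B k).run s).reg 1 ≠ 0) ∧
    (((forTuples B k).run s).reg 1 ≠ 0 → s.reg 1 ≠ 0 ∨ q) := by
  induction k with
  | zero =>
    intro s hG hs
    obtain ⟨h1, h2, h3⟩ := hspec s hG fun i hi => hs i (Nat.zero_le i) hi
    refine ⟨h1, fun t _ ht hp => h2 ?_, h3⟩
    have : t = fun i => s.reg (30 + 2 * i) := funext fun i => ht i (Nat.zero_le i)
    rwa [← this]
  | succ k ih =>
    intro s hG hs
    have hw := forTuples_wellFormed hB hB' (k + 1)
    have := run_each_induct hw hG.size
      (fun j s' => (s.reg 1 ≠ 0 → s'.reg 1 ≠ 0) ∧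
        (∀ t : ℕ → ℕ, (∀ i, i < k + 1 → t i < n) → (∀ i, k + 1 ≤ i → t i = s.reg (30 + 2 * i)) →
          t k < j → p t → s'.reg 1 ≠ 0) ∧ (s'.reg 1 ≠ 0 → s.reg 1 ≠ 0 ∨ q))
      (fun j s' v w h => by
        have h1 : ((s'.setReg (30 + 2 * k) v).setReg (30 + 2 * k + 1) w).reg 1 = s'.reg 1 := by
          rw [RamState.setReg_reg, RamState.setReg_reg, if_neg (by omega), if_neg (by omega)]
        rw [h1]
        exact h)
      ⟨id, fun t _ _ h => absurd h (Nat.not_lt_zero _), Or.inl⟩ ?_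
    · exact ⟨this.1, fun t h1 h2 hp => this.2.1 t h1 h2 (h1 k (by omega)) hp, this.2.2⟩
    · rintro j s' hj hreg hbank hx hx1 ⟨h1, h2, h3⟩
      have hG' : HoldsGraph G s' := hG.of_eq (hreg 0 (by omega) (by omega)
        hw.2.2.2.not_writesReg_zero) (hbank 0 fun h => hB0 (forTuples_writesBank h))
      have hbig : ∀ y, 30 + 2 * (k + 1) ≤ y → s'.reg y = s.reg y := by
        intro y hy
        refine hreg y (by omega) (by omega) fun h => ?_
        rcases forTuples_writesReg h with h | h
        · have := hB' y h; omega
        · omega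
      obtain ⟨g1, g2, g3⟩ := ih s' hG' (by
        intro i hki him
        by_cases hik : i = k
        · subst hik
          have e : 31 + 2 * i = 30 + 2 * i + 1 := by omega
          rw [e, hx1, hx]
          exact ⟨hj, rfl⟩
        · rw [hbig _ (by omega), hbig _ (by omega)]
          exact hs i (by omega) him)
      refine ⟨fun h => g1 (h1 h), fun t ht ht' htj hp => ?_, fun h => (g3 h).elim h3 Or.inr⟩
      by_cases htk : t k = j
      · refine g2 t (fun i hi => ht i (by omega)) (fun i hi => ?_) hp
        by_cases hik : i = k
        · rw [hik, htk, hx]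
        · rw [ht' i (by omega), hbig _ (by omega)]
      · exact g1 (h2 t ht ht' (by omega) hp)

/-! #### Search for an induced subgraph -/

/-- Sum of a list of expressions. -/
def sumExpr : List RamExpr → RamExpr
  | [] => .const 0
  | e :: l => .add e (sumExpr l)

theorem eval_sumExpr_eq_zero (s : RamState) (l : List RamExpr) :
    (sumExpr l).eval s = 0 ↔ ∀ e ∈ l, e.eval s = 0 := by
  induction l with
  | nil => simp [sumExpr, RamExpr.eval]
  | cons e l ih => simp [sumExpr, RamExpr.eval, ih]

open Classical in
/-- Expression that is zero if and only if the vertices in the registers of the `i`-th and `j`-th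
component of a tuple are related as are `i` and `j` in `F`. -/
noncomputable def pairExpr {k : ℕ} (F : SimpleGraph (Fin k)) (i j : Fin k) : RamExpr :=
  if F.Adj i j then .sub (.const 1) (.get 0 (.add (.var (31 + 2 * i)) (.var (30 + 2 * j))))
  else .add (.get 0 (.add (.var (31 + 2 * i)) (.var (30 + 2 * j))))
    (if i = j then .const 0
      else .sub (.const 1) (neExpr (.var (30 + 2 * i)) (.var (30 + 2 * j))))

/-- Set register `1` if the vertices in the tuple registers induce a copy of `F`. -/
noncomputable def inducedBody {k : ℕ} (F : SimpleGraph (Fin k)) : ForProg :=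
  ite (sumExpr ((List.finRange k).flatMap fun i => (List.finRange k).map fun j => pairExpr F i j))
    skip (assign 1 (.const 1))

/-- All summands are natural numbers, so the sum vanishes exactly if every pair has the right
adjacency and distinct indices carry distinct vertices. -/
theorem isSearchBody_inducedBody {n k : ℕ} (G : SimpleGraph (Fin n)) (F : SimpleGraph (Fin k)) :
    IsSearchBody G (inducedBody F) k (fun t => ∃ f : F ↪g G, ∀ i : Fin k, t i = f i)
      (Nonempty (F ↪g G)) := by
  intro s hG hs
  let f : Fin k → Fin n := fun i => ⟨s.reg (30 + 2 * i), (hs i i.2).1⟩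
  have hpair : ∀ i j, (pairExpr F i j).eval s = 0 ↔
      ((F.Adj i j ↔ G.Adj (f i) (f j)) ∧ (f i = f j → i = j)) := by
    intro i j
    have hget : s.bank 0 (s.reg (31 + 2 * i) + s.reg (30 + 2 * j)) ≠ 0 ↔ G.Adj (f i) (f j) := by
      rw [(hs i i.2).2]
      exact hG.adj (f i) (f j)
    have hne : (neExpr (.var (30 + 2 * i)) (.var (30 + 2 * j))).eval s ≠ 0 ↔ f i ≠ f j := by
      rw [eval_neExpr]
      simp [RamExpr.eval, f, Fin.ext_iff]
    by_cases hF : F.Adj i j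
    · have he : (pairExpr F i j).eval s =
          1 - s.bank 0 (s.reg (31 + 2 * i) + s.reg (30 + 2 * j)) := by
        simp [pairExpr, hF, RamExpr.eval]
      rw [he, ← hget]
      constructor
      · intro h
        exact ⟨⟨fun _ => by omega, fun _ => hF⟩, fun e => ((hget.1 (by omega)).ne e).elim⟩
      · intro h
        have := h.1.1 hF
        omega
    · have he : (pairExpr F i j).eval s =
          s.bank 0 (s.reg (31 + 2 * i) + s.reg (30 + 2 * j)) +
            if i = j then 0
            else 1 - (neExpr (.var (30 + 2 * i)) (.var (30 + 2 * j))).eval s := by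
        by_cases hij : i = j
        · simp [pairExpr, hij, RamExpr.eval]
        · simp [pairExpr, hF, hij, RamExpr.eval]
      rw [he, ← hget, Nat.add_eq_zero_iff]
      simp only [hF, false_iff, not_not]
      refine and_congr Iff.rfl ?_
      by_cases hij : i = j
      · simp [hij]
      · rw [if_neg hij]
        simp only [hij, imp_false]
        rw [← ne_eq (f i), ← hne]
        omega
  have hsum : (sumExpr ((List.finRange k).flatMap fun i =>
      (List.finRange k).map fun j => pairExpr F i j)).eval s = 0 ↔
      ∀ i j, (F.Adj i j ↔ G.Adj (f i) (f j)) ∧ (f i = f j → i = j) := by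
    rw [eval_sumExpr_eq_zero]
    simp only [List.mem_flatMap, List.mem_map, List.mem_finRange, true_and, forall_exists_index]
    constructor
    · intro h i j
      exact (hpair i j).1 (h _ i j rfl)
    · rintro h _ i j rfl
      exact (hpair i j).2 (h i j)
  refine ⟨fun h => ?_, ?_, fun h => ?_⟩
  · simp only [inducedBody, run]
    split_ifs
    · exact h
    · simp [RamExpr.eval]
  · rintro ⟨g, hg⟩
    have hfg : ∀ i, f i = g i := fun i => Fin.ext (hg i)
    have hzero := hsum.2 fun i j => by
      rw [hfg, hfg]
      exact ⟨g.map_rel_iff.symm, fun e => g.injective e⟩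
    rw [inducedBody, run, if_neg (not_not.2 hzero)]
    simp [run, RamExpr.eval]
  · by_cases hzero : (sumExpr ((List.finRange k).flatMap fun i =>
      (List.finRange k).map fun j => pairExpr F i j)).eval s = 0
    · have := hsum.1 hzero
      exact Or.inr ⟨⟨⟨f, fun i j e => (this i j).2 e⟩, fun {i j} => (this i j).1.symm⟩⟩
    · rw [inducedBody, run, if_pos hzero] at h
      exact Or.inl h

/-! #### Search for a perfect matching cut -/

/-- Color the vertices of the first `k` tuple registers in bank `4`, the first `m` of them with
color `1`, the others with color `2`. -/
def plant (m : ℕ) : ℕ → ForProg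
  | 0 => skip
  | k + 1 => seq (plant m k) (put 4 (.var (30 + 2 * k)) (.const (if k < m then 1 else 2)))

theorem plant_wellFormed (m k : ℕ) : (plant m k).WellFormed := by
  induction k with
  | zero => trivial
  | succ k ih => exact ⟨ih, trivial⟩

theorem plant_not_writesReg (m k y : ℕ) : ¬ (plant m k).WritesReg y := by
  induction k with
  | zero => exact id
  | succ k ih => exact not_or.2 ⟨ih, id⟩

theorem plant_writesBank {m k c : ℕ} (h : (plant m k).WritesBank c) : c = 4 := by
  induction k with
  | zero => exact h.elim
  | succ k ih => exact h.elim ih id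

/-- A tuple may repeat a vertex, and then the last write wins; so a color is explained by some index
with that vertex, not by every such index. -/
theorem run_plant {n m : ℕ} {s : RamState} (hs : ∀ v, coloring n s 4 v = 0) (k : ℕ)
    (hk : ∀ i, i < k → s.reg (30 + 2 * i) < n) :
    (∀ v, coloring n ((plant m k).run s) 4 v ≠ 0 → ∃ i, i < k ∧ s.reg (30 + 2 * i) = v ∧
      coloring n ((plant m k).run s) 4 v = if i < m then 1 else 2) ∧
    ∀ i, i < k → ∀ v : Fin n, s.reg (30 + 2 * i) = v → coloring n ((plant m k).run s) 4 v ≠ 0 := by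
  induction k with
  | zero => exact ⟨fun v hv => (hv (hs v)).elim, fun i hi => absurd hi (Nat.not_lt_zero i)⟩
  | succ k ih =>
    obtain ⟨h1, h2⟩ := ih fun i hi => hk i (by omega)
    let w : Fin n := ⟨s.reg (30 + 2 * k), hk k (by omega)⟩
    have hrun : coloring n ((plant m (k + 1)).run s) 4 =
        Function.update (coloring n ((plant m k).run s) 4) w (if k < m then 1 else 2) := by
      rw [← coloring_setCell]
      simp only [plant, run, RamExpr.eval]
      rw [run_reg_of_not_writes (plant_not_writesReg m k _)]
    rw [hrun]
    constructor
    · intro v hv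
      by_cases hvw : v = w
      · subst hvw
        exact ⟨k, by omega, rfl, by rw [Function.update_self]⟩
      · rw [Function.update_of_ne hvw] at hv ⊢
        obtain ⟨i, hi, h⟩ := h1 v hv
        exact ⟨i, by omega, h⟩
    · intro i hi v hv
      by_cases hvw : v = w
      · subst hvw
        rw [Function.update_self]
        split_ifs <;> simp
      · rw [Function.update_of_ne hvw]
        have : i ≠ k := by
          rintro rfl
          exact hvw (Fin.ext hv.symm)
        exact h2 i (by omega) v hv

/-- Erase the coloring in bank `4`. -/
def eraseBank : ForProg := each 20 (put 4 (.var 20) (.const 0))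

/-- Set register `1` if the greedy completion of the coloring given by a tuple is perfect. -/
def cutBody (m : ℕ) : ForProg :=
  seq eraseBank (seq (plant m (2 * m)) (seq greedy (seq (checkBank 4)
    (ite (.var 2) (assign 1 (.const 1)) skip))))

theorem eraseBank_wellFormed : eraseBank.WellFormed := by
  simp [eraseBank, WellFormed, WritesReg]

theorem run_eraseBank {n : ℕ} {s : RamState} (hs : s.reg 0 = n) (v : Fin n) :
    coloring n (eraseBank.run s) 4 v = 0 := by
  have := run_each_induct eraseBank_wellFormed hs
    (fun k s' => ∀ v : Fin n, (v : ℕ) < k → s'.bank 4 v = 0)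
    (fun k s' v w h => by simpa using h) (fun v hv => absurd hv (Nat.not_lt_zero _)) ?_
  · exact this v v.2
  · intro k s' hk _ hb hx _ hInv v hv
    simp only [run, RamExpr.eval, RamState.setCell_bank, hx, true_and]
    split_ifs with h
    · rfl
    · exact hInv v (by omega)

theorem cutBody_wellFormed (m : ℕ) : (cutBody m).WellFormed :=
  ⟨eraseBank_wellFormed, plant_wellFormed m _, greedy_wellFormed, checkBank_wellFormed 4,
    Nat.one_ne_zero, trivial⟩

theorem cutBody_writesReg {m y : ℕ} (h : (cutBody m).WritesReg y) : y < 30 := by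
  simp only [cutBody, eraseBank, WritesReg, or_false] at h
  rcases h with h | h | h | h | h
  · omega
  · exact (plant_not_writesReg _ _ _ h).elim
  · have := greedy_writesReg h; omega
  · have := checkBank_writesReg h; omega
  · omega

theorem cutBody_not_writesBank (m : ℕ) : ¬ (cutBody m).WritesBank 0 := by
  intro h
  simp only [cutBody, eraseBank, WritesBank, or_false] at h
  rcases h with h | h | h | h
  · omega
  · have := plant_writesBank h; omega
  · have := greedy_writesBank h; omega
  · exact checkBank_not_writesBank _ _ h

/-- The coloring given by a tuple extends to a perfect coloring, and its closed extensions are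
reduced. -/
def IsGoodSeed {n : ℕ} (G : SimpleGraph (Fin n)) (m : ℕ) (t : ℕ → ℕ) : Prop :=
  (∃ σ, IsPerfect G σ ∧ ∀ i, i < 2 * m → ∀ v : Fin n, t i = v → σ v = if i < m then 1 else 2) ∧
  ∀ Q τ, (∀ i, i < 2 * m → ∀ v : Fin n, t i = v → Q v = if i < m then 1 else 2) →
    IsPerfect G τ → Extends Q τ → IsClosed G 2 Q → IsReduced G Q τ

/-- Soundness needs no assumption on the tuple: the completion is total, and a total consistent
coloring is perfect. Good seeds only ensure that the search succeeds. -/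
theorem isSearchBody_cutBody {n : ℕ} (G : SimpleGraph (Fin n)) (m : ℕ) :
    IsSearchBody G (cutBody m) (2 * m) (IsGoodSeed G m) (∃ σ, IsPerfect G σ) := by
  intro s hG hs
  set s₁ := eraseBank.run s with hs₁
  have hG₁ : HoldsGraph G s₁ := hG.run eraseBank_wellFormed (by simp [eraseBank, WritesBank])
  have hreg₁ : ∀ y, y ≠ 20 → y ≠ 21 → s₁.reg y = s.reg y := fun y h1 h2 =>
    run_reg_of_not_writes (by simp [eraseBank, WritesReg, h1, h2]) s
  set s₂ := (plant m (2 * m)).run s₁ with hs₂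
  have hG₂ : HoldsGraph G s₂ := hG₁.run (plant_wellFormed _ _) fun h => by
    have := plant_writesBank h; omega
  obtain ⟨hp1, hp2⟩ := run_plant (n := n) (m := m) (s := s₁) (run_eraseBank hG.size) (2 * m)
    fun i hi => by rw [hreg₁ _ (by omega) (by omega)]; exact (hs i hi).1
  rw [← hs₂] at hp1 hp2
  set P := coloring n s₂ 4 with hP
  have hP2 : IsPartial P := by
    intro v
    by_cases hv : P v = 0
    · omega
    · obtain ⟨i, -, -, h⟩ := hp1 v hv
      rw [h]
      split_ifs <;> omega
  have hreg : ∀ i, s₁.reg (30 + 2 * i) = s.reg (30 + 2 * i) := fun i =>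
    hreg₁ _ (by omega) (by omega)
  obtain ⟨g1, g2, g3⟩ := run_greedy hG₂ hP.symm hP2 rfl
  set s₃ := greedy.run s₂ with hs₃
  have hG₃ : HoldsGraph G s₃ := hG₂.run greedy_wellFormed fun h => by
    have := greedy_writesBank h; omega
  have hcheck := run_checkBank hG₃ 4
  set s₄ := (checkBank 4).run s₃ with hs₄
  have h1 : s₄.reg 1 = s.reg 1 := by
    rw [hs₄, run_reg_of_not_writes (fun h => by have := checkBank_writesReg h; omega), hs₃,
      run_reg_of_not_writes (fun h => by have := greedy_writesReg h; omega), hs₂,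
      run_reg_of_not_writes (plant_not_writesReg _ _ _), hreg₁ 1 (by omega) (by omega)]
  have hrun : ((cutBody m).run s).reg 1 = if s₄.reg 2 ≠ 0 then 1 else s.reg 1 := by
    have : (cutBody m).run s = (ite (.var 2) (assign 1 (.const 1)) skip).run s₄ := rfl
    rw [this, run]
    by_cases h : s₄.reg 2 ≠ 0
    · rw [if_pos h, if_pos (show (RamExpr.var 2).eval s₄ ≠ 0 from h)]; simp [run, RamExpr.eval]
    · rw [if_neg h, if_neg (show ¬ (RamExpr.var 2).eval s₄ ≠ 0 from h)]; exact h1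
  rw [hrun]
  refine ⟨fun h => ?_, ?_, fun h => ?_⟩
  · split_ifs
    · exact Nat.one_ne_zero
    · exact h
  · rintro ⟨⟨σ, hσ, hσt⟩, hred⟩
    have hext : ∀ Q, Extends P Q → ∀ i, i < 2 * m → ∀ v : Fin n, s.reg (30 + 2 * i) = v →
        Q v = σ v := by
      intro Q hQ i hi v hv
      have h0 := hp2 i hi v ((hreg i).trans hv)
      obtain ⟨j, hj, hjv, hjc⟩ := hp1 v h0
      rw [hQ v h0, hjc, hσt j hj v ((hreg j).symm.trans hjv)]
    have hperf := g3 (fun R τ hPR hτ hRτ hR => hred R τ (fun i hi v hv => by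
      rw [hext R hPR i hi v hv, hσt i hi v hv]) hτ hRτ hR) ⟨σ, hσ, fun v hv => by
        obtain ⟨j, hj, hjv, hjc⟩ := hp1 v hv
        rw [hjc, hσt j hj v ((hreg j).symm.trans hjv)]⟩
    rw [if_pos (hcheck.2 hperf.isConsistent)]
    exact Nat.one_ne_zero
  · by_cases hc : s₄.reg 2 ≠ 0
    · exact Or.inr ⟨_, IsPerfect.of_isConsistent g1 g2 (hcheck.1 hc)⟩
    · rw [if_neg hc] at h
      exact Or.inl h

/-! ### The algorithm -/

theorem holdsGraph_inputState {n : ℕ} (G : SimpleGraph (Fin n)) :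
    HoldsGraph G (inputState G) := by
  refine ⟨rfl, fun i j => ?_⟩
  have hn : 0 < n := i.pos
  simp only [inputState, true_and, ne_eq, ite_eq_right_iff, Nat.one_ne_zero, imp_false, not_not]
  constructor
  · rintro ⟨i', j', he, h⟩
    have hj : (j : ℕ) = j' := by
      -- Both column indices are below `n`, so reduction modulo `n` recovers them from the address.
      have := congrArg (· % n) he
      simpa [Nat.add_mod, Nat.mod_eq_of_lt j.2, Nat.mod_eq_of_lt j'.2] using this
    have hi : (i : ℕ) = i' := by
      rw [hj] at he
      exact Nat.eq_of_mul_eq_mul_right hn (Nat.add_right_cancel he)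
    rwa [Fin.ext hi, Fin.ext hj]
  · exact fun h => ⟨i, j, rfl, h⟩

/-- Erase the registers of `k`-tuples. -/
def clearTuple : ℕ → ForProg
  | 0 => skip
  | k + 1 => seq (clearTuple k) (seq (assign (30 + 2 * k) (.const 0))
      (assign (31 + 2 * k) (.const 0)))

theorem clearTuple_wellFormed (k : ℕ) : (clearTuple k).WellFormed := by
  induction k with
  | zero => trivial
  | succ k ih => exact ⟨ih, Nat.ne_of_gt (by omega), Nat.ne_of_gt (by omega)⟩

theorem run_clearTuple (k : ℕ) (s : RamState) : ((clearTuple k).run s).bank = s.bank ∧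
    ∀ y, ((clearTuple k).run s).reg y = if 30 ≤ y ∧ y < 30 + 2 * k then 0 else s.reg y := by
  induction k with
  | zero => exact ⟨rfl, fun y => by rw [if_neg (by omega)]; rfl⟩
  | succ k ih =>
    refine ⟨ih.1, fun y => ?_⟩
    simp only [clearTuple, run, RamExpr.eval, RamState.setReg_reg, ih.2]
    split_ifs <;> first | rfl | omega

theorem inducedBody_wellFormed {k : ℕ} (F : SimpleGraph (Fin k)) :
    (inducedBody F).WellFormed :=
  ⟨trivial, Nat.one_ne_zero⟩

theorem inducedBody_writesReg {k y : ℕ} {F : SimpleGraph (Fin k)}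
    (h : (inducedBody F).WritesReg y) : y = 1 := by
  simpa [inducedBody, WritesReg] using h

theorem inducedBody_not_writesBank {k : ℕ} (F : SimpleGraph (Fin k)) (c : ℕ) :
    ¬ (inducedBody F).WritesBank c := by
  simp [inducedBody, WritesBank]

/-- An embedding of `F` and an induced path on four vertices without edges in between form an
embedding of the disjoint union. -/
theorem not_isFree_of_path {V W : Type*} {F : SimpleGraph W} {G : SimpleGraph V} (f : F ↪g G)
    {a b c d : V} (hab : G.Adj a b) (hbc : G.Adj b c) (hcd : G.Adj c d) (hac' : a ≠ c)
    (had' : a ≠ d) (hbd' : b ≠ d) (hac : ¬ G.Adj a c) (had : ¬ G.Adj a d) (hbd : ¬ G.Adj b d)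
    (hf : ∀ i, ∀ v, v = a ∨ v = b ∨ v = c ∨ v = d → f i ≠ v ∧ ¬ G.Adj (f i) v) :
    ¬ IsFree (F ⊕g SimpleGraph.pathGraph 4) G := by
  have hmem : ∀ x : Fin 4, ![a, b, c, d] x = a ∨ ![a, b, c, d] x = b ∨ ![a, b, c, d] x = c ∨
      ![a, b, c, d] x = d := by
    intro x; fin_cases x <;> simp
  have hinj : Function.Injective ![a, b, c, d] := by
    intro x y
    have := hab.ne
    have := hbc.ne
    have := hcd.ne
    fin_cases x <;> fin_cases y <;> simp_all [eq_comm]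
  have hca : ¬ G.Adj c a := fun h => hac h.symm
  have hda : ¬ G.Adj d a := fun h => had h.symm
  have hdb : ¬ G.Adj d b := fun h => hbd h.symm
  have hadj : ∀ x y : Fin 4, G.Adj (![a, b, c, d] x) (![a, b, c, d] y) ↔
      (SimpleGraph.pathGraph 4).Adj x y := by
    intro x y
    rw [SimpleGraph.pathGraph_adj]
    fin_cases x <;> fin_cases y <;> simp [hab, hbc, hcd, hac, had, hbd, hab.symm, hbc.symm,
      hcd.symm, hca, hda, hdb]
  refine not_not.2 ⟨⟨⟨Sum.elim f ![a, b, c, d], ?_⟩, ?_⟩⟩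
  · exact f.injective.sumElim hinj fun i x => (hf i _ (hmem x)).1
  · rintro (i | x) (j | y)
    · simp
    · simpa using (hf i _ (hmem y)).2
    · simpa [G.adj_comm] using (hf j _ (hmem x)).2
    · simpa using hadj x y

/-- On a connected graph with a perfect coloring, an induced copy of `F` yields a good seed. -/
theorem exists_isGoodSeed {n k : ℕ} {G : SimpleGraph (Fin n)} {F : SimpleGraph (Fin k)}
    (hconn : G.Connected) (hfree : IsFree (F ⊕g SimpleGraph.pathGraph 4) G) (f : F ↪g G)
    {σ : Fin n → ℕ} (hσ : IsPerfect G σ) :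
    ∃ t : ℕ → ℕ, (∀ i, i < 2 * (k + 1) → t i < n) ∧ (∀ i, 2 * (k + 1) ≤ i → t i = 0) ∧
      IsGoodSeed G (k + 1) t := by
  obtain ⟨v₀⟩ := hconn.nonempty
  choose p hp _ using hσ.2
  -- The extra entry `k` is an arbitrary vertex, so that the seed colors something even if `F` has
  -- no vertices.
  let g : ℕ → Fin n := fun i => if h : i < k then f ⟨i, h⟩ else v₀
  let red : ℕ → Fin n := fun i => if σ (g i) = 1 then g i else p (g i)
  let blue : ℕ → Fin n := fun i => if σ (g i) = 1 then p (g i) else g i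
  have hred : ∀ i, σ (red i) = 1 := by
    intro i
    by_cases h : σ (g i) = 1
    · simp [red, h]
    · have h1 := (hp (g i)).2
      have h2 := hσ.1 (g i)
      have h3 := hσ.1 (p (g i))
      simp only [red, if_neg h]
      omega
  have hblue : ∀ i, σ (blue i) = 2 := by
    intro i
    by_cases h : σ (g i) = 1
    · have h1 := (hp (g i)).2
      have h3 := hσ.1 (p (g i))
      simp only [blue, if_pos h]
      omega
    · have h2 := hσ.1 (g i)
      simp only [blue, if_neg h]
      omega
  let t : ℕ → ℕ := fun i => if i < k + 1 then red i
    else if i < 2 * (k + 1) then blue (i - (k + 1)) else 0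
  have ht1 : ∀ i, i < k + 1 → t i = red i := fun i hi => if_pos hi
  have ht2 : ∀ i, i < k + 1 → t (k + 1 + i) = blue i := fun i hi => by
    simp only [t]
    rw [if_neg (by omega), if_pos (by omega), Nat.add_sub_cancel_left]
  refine ⟨t, fun i hi => ?_, fun i hi => ?_, ⟨σ, hσ, fun i hi v hv => ?_⟩, ?_⟩
  · by_cases h : i < k + 1
    · rw [ht1 i h]; exact (red i).2
    · have := ht2 (i - (k + 1)) (by omega)
      rw [Nat.add_sub_cancel' (by omega)] at this
      rw [this]; exact (blue _).2
  · simp only [t]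
    rw [if_neg (by omega), if_neg (by omega)]
  · by_cases h : i < k + 1
    · rw [ht1 i h] at hv
      rw [if_pos h, ← Fin.ext hv, hred]
    · have := ht2 (i - (k + 1)) (by omega)
      rw [Nat.add_sub_cancel' (by omega)] at this
      rw [this] at hv
      rw [if_neg h, ← Fin.ext hv, hblue]
  · intro Q τ hQ hτ hQτ hcl
    have hQr : ∀ i, i < k + 1 → Q (red i) = 1 := fun i hi => by
      rw [hQ i (by omega) (red i) (ht1 i hi), if_pos hi]
    have hQb : ∀ i, i < k + 1 → Q (blue i) = 2 := fun i hi => by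
      rw [hQ (k + 1 + i) (by omega) (blue i) (ht2 i hi), if_neg (by omega)]
    have hQg : ∀ i, i < k + 1 → Q (g i) ≠ 0 ∧ Q (p (g i)) ≠ 0 ∧ Q (p (g i)) ≠ Q (g i) := by
      intro i hi
      have h1 := hQr i hi
      have h2 := hQb i hi
      by_cases h : σ (g i) = 1
      · simp only [red, if_pos h] at h1
        simp only [blue, if_pos h] at h2
        omega
      · simp only [red, if_neg h] at h1
        simp only [blue, if_neg h] at h2
        omega
    -- The partner of `g i` is colored, so `g i` passes its color to its remaining neighbors.
    have hnbr : ∀ i, i < k + 1 → ∀ u, G.Adj (g i) u → Q u ≠ 0 := by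
      intro i hi u hu
      obtain ⟨h1, h2, h3⟩ := hQg i hi
      by_cases hup : u = p (g i)
      · rwa [hup]
      · rw [hcl.of_succ.eq_of_matched h1 (hp (g i)).1 h2 h3 hu hup]
        exact h1
    refine ⟨hτ, hQτ, hcl, hconn, ⟨g k, (hQg k (by omega)).1⟩, ?_⟩
    -- Uncolored vertices are neither in the copy of `F` nor adjacent to it, so an induced path
    -- among them would complete the copy to the excluded graph.
    intro a b c d ha hb hc hd hab hbc hcd hac' had' hbd' hac had hbd
    refine not_isFree_of_path f hab hbc hcd hac' had' hbd' hac had hbd (fun i v hv => ?_) hfree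
    have hv0 : Q v = 0 := by
      rcases hv with rfl | rfl | rfl | rfl <;> assumption
    have hgi : g i = f i := by simp [g]
    rw [← hgi]
    exact ⟨fun e => (hQg i (by omega)).1 (e ▸ hv0), fun e => hnbr i (by omega) v e hv0⟩

/-- Given an algorithm for `F`-free graphs, search for an induced copy of `F`; run the given
algorithm if there is none, and otherwise search for a perfect matching cut. -/
noncomputable def combined {k : ℕ} (F : SimpleGraph (Fin k)) (P : RamProg) : RamProg :=
  .seq (forTuples (inducedBody F) k).compile
    (.ite (.var 1)
      (.seq (seq (assign 1 (.const 0)) (forTuples (cutBody (k + 1)) (2 * (k + 1)))).compile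
        (.ite (.var 1) (.assign 0 (.const 1)) (.assign 0 (.const 0))))
      (.seq (clearTuple k).compile P))

theorem perfectMatchingCutPolyOnFree_add_path {k : ℕ} (F : SimpleGraph (Fin k))
    (hF : PerfectMatchingCutPolyOnFree F) :
    PerfectMatchingCutPolyOnFree (F ⊕g SimpleGraph.pathGraph 4) := by
  obtain ⟨P, p, hP⟩ := hF
  have hw₁ := forTuples_wellFormed (inducedBody_wellFormed F)
    (fun y h => by have := inducedBody_writesReg h; omega) k
  have hw₂ : (seq (assign 1 (.const 0)) (forTuples (cutBody (k + 1)) (2 * (k + 1)))).WellFormed :=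
    ⟨Nat.one_ne_zero, forTuples_wellFormed (cutBody_wellFormed _)
      (fun y h => cutBody_writesReg h) _⟩
  -- The summand `10` covers the tests and the final assignment; both branches are simply added up.
  refine ⟨combined F P, (forTuples (inducedBody F) k).cost +
    ((seq (assign 1 (.const 0)) (forTuples (cutBody (k + 1)) (2 * (k + 1)))).cost +
      (clearTuple k).cost + p + 10), ?_⟩
  rintro n G ⟨hconn, hfree⟩
  have hne := hconn.nonempty
  have hG := holdsGraph_inputState G
  obtain ⟨t₁, he₁, hle₁⟩ := exec_compile hw₁ (inputState G)
  obtain ⟨-, hfound, hfound'⟩ := run_forTuples (inducedBody_wellFormed F)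
    (fun y h => by have := inducedBody_writesReg h; omega) (inducedBody_not_writesBank F 0)
    (isSearchBody_inducedBody G F) k (inputState G) hG fun i hi hi' => by omega
  set s₁ := (forTuples (inducedBody F) k).run (inputState G) with hs₁
  have hreg₁ : ∀ y, y ≠ 1 → ¬ (30 ≤ y ∧ y < 30 + 2 * k) → s₁.reg y = (inputState G).reg y := by
    intro y hy hy'
    refine run_reg_of_not_writes (fun h => ?_) _
    rcases forTuples_writesReg h with h | h
    · exact hy (inducedBody_writesReg h)
    · exact hy' h
  have hbank₁ : s₁.bank = (inputState G).bank := funext fun a =>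
    run_bank_of_not_writes (fun h => inducedBody_not_writesBank F a (forTuples_writesBank h)) _
  have hG₁ : HoldsGraph G s₁ := hG.of_eq (hreg₁ 0 (by omega) (by omega)) (by rw [hbank₁])
  have hinit : (inputState G).reg 1 = 0 := rfl
  rw [hG.size] at hle₁
  simp only [Polynomial.eval_add, Polynomial.eval_ofNat]
  by_cases hcopy : Nonempty (F ↪g G)
  · obtain ⟨f⟩ := hcopy
    have hflag : s₁.reg 1 ≠ 0 := by
      refine hfound (fun i => if h : i < k then f ⟨i, h⟩ else 0) (fun i hi => ?_)
        (fun i hi => ?_) ⟨f, fun i => ?_⟩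
      · simp [hi]
      · simp [not_lt.2 hi, inputState]
      · simp
    obtain ⟨t₂, he₂, hle₂⟩ := exec_compile hw₂ s₁
    rw [hG₁.size] at hle₂
    have hG₂ : HoldsGraph G (s₁.setReg 1 0) := hG₁.of_eq (by simp) rfl
    obtain ⟨-, hcut, hcut'⟩ := run_forTuples (cutBody_wellFormed (k + 1))
      (fun y h => cutBody_writesReg h) (cutBody_not_writesBank _)
      (isSearchBody_cutBody G (k + 1)) (2 * (k + 1)) (s₁.setReg 1 0) hG₂ fun i hi hi' => by omega
    set s₂ := (forTuples (cutBody (k + 1)) (2 * (k + 1))).run (s₁.setReg 1 0) with hs₂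
    have hrun₂ : (seq (assign 1 (.const 0)) (forTuples (cutBody (k + 1)) (2 * (k + 1)))).run s₁ =
        s₂ := rfl
    rw [hrun₂] at he₂
    have hiff : s₂.reg 1 ≠ 0 ↔ HasPerfectMatchingCut G := by
      rw [hasPerfectMatchingCut_iff]
      constructor
      · intro h
        exact (hcut' h).resolve_left (by simp)
      · rintro ⟨σ, hσ⟩
        obtain ⟨t, ht1, ht2, ht3⟩ := exists_isGoodSeed hconn hfree f hσ
        refine hcut t ht1 (fun i hi => ?_) ht3
        rw [ht2 i hi, RamState.setReg_reg, if_neg (by omega), hreg₁ _ (by omega) (by omega)]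
        simp [inputState]
    by_cases h2 : s₂.reg 1 = 0
    · refine ⟨_, _, Exec.seq he₁ (Exec.ite_true hflag (Exec.seq he₂
        (Exec.ite_false h2 (Exec.assign _ _ _)))), ?_, fun h => ?_, fun _ => ?_⟩
      · simp only [RamExpr.cost]; omega
      · exact (hiff.2 h h2).elim
      · simp [RamExpr.eval]
    · refine ⟨_, _, Exec.seq he₁ (Exec.ite_true hflag (Exec.seq he₂
        (Exec.ite_true h2 (Exec.assign _ _ _)))), ?_, fun _ => ?_, fun h => ?_⟩
      · simp only [RamExpr.cost]; omega
      · simp [RamExpr.eval]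
      · exact (h (hiff.1 h2)).elim
  · have hflag : s₁.reg 1 = 0 := by
      by_contra h
      exact (hfound' h).elim (fun h => h hinit) hcopy
    obtain ⟨t₂, he₂, hle₂⟩ := exec_compile (clearTuple_wellFormed k) s₁
    rw [hG₁.size] at hle₂
    -- Nothing is known about the given program on other states, so the input state is restored
    -- exactly: the flag is already `0` and no bank was written.
    have hclear : (clearTuple k).run s₁ = inputState G := by
      obtain ⟨h1, h2⟩ := run_clearTuple k s₁
      have hr : ((clearTuple k).run s₁).reg = (inputState G).reg := by
        funext y
        rw [h2]
        split_ifs with hy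
        · simp only [inputState]
          rw [if_neg (by omega)]
        · by_cases hy1 : y = 1
          · rw [hy1, hflag, hinit]
          · exact hreg₁ y hy1 hy
      generalize (clearTuple k).run s₁ = s at h1 hr
      cases s
      rw [hbank₁] at h1
      simp only at h1 hr
      rw [h1, hr]
    rw [hclear] at he₂
    obtain ⟨s, t₃, he₃, hle₃, hyes, hno⟩ := hP n G ⟨hconn, hcopy⟩
    refine ⟨s, _, Exec.seq he₁ (Exec.ite_false hflag (Exec.seq he₂ he₃)), ?_, hyes, hno⟩
    simp only [RamExpr.cost]
    omega

/-- Solvability for `H`-free graphs depends on `H` only up to isomorphism. -/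
theorem PerfectMatchingCutPolyOnFree.congr {W W' : Type*} {H : SimpleGraph W}
    {H' : SimpleGraph W'} (e : H ≃g H') (h : PerfectMatchingCutPolyOnFree H) :
    PerfectMatchingCutPolyOnFree H' := by
  obtain ⟨P, p, hP⟩ := h
  refine ⟨P, p, fun n G hG => hP n G ⟨hG.1, fun ⟨f⟩ => hG.2 ⟨f.comp e.symm.toEmbedding⟩⟩⟩

end PMC

/-- `H ⊕g SimpleGraph.pathGraph 4` is the disjoint union of `H` and the path on four vertices. -/
theorem theorem4p10 {W : Type*} [Finite W] (H : SimpleGraph W)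
    (hH : PMC.PerfectMatchingCutPolyOnFree H) :
    PMC.PerfectMatchingCutPolyOnFree (H ⊕g SimpleGraph.pathGraph 4) := by
  -- The search needs the vertices of `H` numbered, so `H` is replaced by an isomorphic graph on
  -- `Fin`.
  let e : H.comap (Finite.equivFin W).symm ≃g H :=
    SimpleGraph.Iso.comap (Finite.equivFin W).symm H
  refine PMC.PerfectMatchingCutPolyOnFree.congr ?_
    (PMC.perfectMatchingCutPolyOnFree_add_path _ (hH.congr e.symm))
  exact ⟨Equiv.sumCongr e.toEquiv (Equiv.refl _), by
    rintro (i | x) (j | y) <;> simp [e.map_adj_iff]⟩
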